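/- **Theorem (generalized Caffarelli–Kohn–Nirenberg inequality).** Let $(M,g)$ be a smooth Riemannian $2$-manifold without boundary (Hausdorff, second countable), and let $\Omega\subset M$ be an open set (in particular, any smooth open domain). Let $\kappa,\omega:M\to\mathbb R$ be functions such that $\omega>0$ almost everywhere in $\Omega$, $\omega\in W^{1,2}_{\rm loc}(\Omega)$ with weak gradient $\nabla\omega$, $\kappa\omega^2\in L^1_{\rm loc}(\Omega)$, and $\omega^2\Delta_g\ln\omega=-\kappa\,\omega^2$ weakly in $\Omega$, that is, $$\int_\Omega \big(4|\nabla\omega|^2-2\kappa\,\omega^2\big)\varphi-\omega^2\Delta_g\varphi\;d\mathrm{vol}_g=0\qquad\text{for all }\varphi\in C_c^\infty(\Omega).$$ Let $$\lambda_1(\Omega)=\inf\Big\{\frac{\int_\Omega|\nabla u|^2\,d\mathrm{vol}_g}{\int_\Omega u^2\,d\mathrm{vol}_g}\;:\;u\in C_c^\infty(\Omega),\ u\neq 0\Big\}$$ be the first Dirichlet eigenvalue of $-\Delta_g$ on $\Omega$ (with $\lambda_1(\emptyset)=0$). If $\kappa\le\lambda_1(\Omega)$ almost everywhere in $\Omega$,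 then for every real-valued $f\in C_c^\infty(\Omega)$ $$\int_\Omega|\nabla\omega|^2|f|^2\,d\mathrm{vol}_g\le\int_\Omega\omega^2|\nabla f|^2\,d\mathrm{vol}_g .$$ -/

import Mathlib

open MeasureTheory Bundle
open scoped Manifold ContDiff ENNReal

noncomputable section

namespace WeightedCKN

/-- The model space of surfaces. -/
abbrev Plane : Type := EuclideanSpace ℝ (Fin 2)

section Riemannian

variable {M : Type*} [TopologicalSpace M] [ChartedSpace Plane M]

/-! ### Riemannian surfaces: volume, gradient, divergence, Laplacian -/

section Metric

variable [RiemannianBundle (fun x : M => TangentSpace (𝓡 2) x)]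

/-- The coordinate vector field `∂ᵢ` of the chart `e`, at the point of `M` with coordinates `y`. -/
def coordField (e : OpenPartialHomeomorph M Plane) (i : Fin 2) (y : Plane) :
    TangentSpace (𝓡 2) (e.symm y) :=
  mfderiv (𝓡 2) (𝓡 2) e.symm y (EuclideanSpace.single i (1 : ℝ) : Plane)

/-- The matrix `gᵢⱼ = ⟨∂ᵢ, ∂ⱼ⟩` of the metric in the chart `e`. -/
def metricMatrix (e : OpenPartialHomeomorph M Plane) (y : Plane) : Matrix (Fin 2) (Fin 2) ℝ :=
  Matrix.of fun i j => inner ℝ (coordField e i y) (coordField e j y)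

/-- The Riemannian density `√(det gᵢⱼ)` in the chart `e`. -/
def density (e : OpenPartialHomeomorph M Plane) (y : Plane) : ℝ :=
  √(metricMatrix e y).det

/-- The measure `√(det gᵢⱼ) dy` of the chart `e`, carried to the domain of `e` in `M`
(and zero outside this domain). -/
def chartMeasure [MeasurableSpace M] (e : OpenPartialHomeomorph M Plane) : Measure M :=
  ((volume.restrict e.target).withDensity fun y => ENNReal.ofReal (density e y)).map e.symm

variable (M) in
/-- The Riemannian volume `dvol_g`: the smallest measure that dominates `√(det gᵢⱼ) dy` in
every chart. As these measures agree on the overlaps of the charts, it is the measure that equals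
`√(det gᵢⱼ) dy` in every chart. -/
def vol [MeasurableSpace M] : Measure M :=
  ⨆ p : M, chartMeasure (chartAt Plane p)

/-- The gradient `∇u`, characterized by `⟨∇u, v⟩ = du(v)` for all tangent vectors `v`. -/
def grad (u : M → ℝ) (x : M) : TangentSpace (𝓡 2) x :=
  haveI : FiniteDimensional ℝ (TangentSpace (𝓡 2) x) :=
    inferInstanceAs (FiniteDimensional ℝ Plane)
  haveI : CompleteSpace (TangentSpace (𝓡 2) x) := FiniteDimensional.complete ℝ _
  (InnerProductSpace.toDual ℝ (TangentSpace (𝓡 2) x)).symm (mfderiv (𝓡 2) 𝓘(ℝ, ℝ) u x)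

/-- The `i`-th component in the chart `e` of a vector field `Y`, as a function of the
coordinates. -/
def component (e : OpenPartialHomeomorph M Plane) (Y : Π x : M, TangentSpace (𝓡 2) x)
    (i : Fin 2) (y : Plane) : ℝ :=
  let v : Plane := mfderiv (𝓡 2) (𝓡 2) e (e.symm y) (Y (e.symm y))
  v i

/-- The divergence `(1/√det g) ∑ᵢ ∂ᵢ(√det g Yⁱ)` of a vector field, computed at `x` in the
preferred chart at `x`. -/
def divergence (Y : Π x : M, TangentSpace (𝓡 2) x) (x : M) : ℝ :=
  (density (chartAt Plane x) (chartAt Plane x x))⁻¹ *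
    ∑ i : Fin 2, fderiv ℝ
      (fun y => density (chartAt Plane x) y * component (chartAt Plane x) Y i y)
      (chartAt Plane x x) (EuclideanSpace.single i (1 : ℝ))

/-- The Laplace–Beltrami operator `Δ_g u = div ∇u` on smooth functions. -/
def laplacian (u : M → ℝ) (x : M) : ℝ :=
  divergence (grad u) x

theorem inner_grad (u : M → ℝ) (x : M) (v : TangentSpace (𝓡 2) x) :
    (inner ℝ (grad u x) v : ℝ) = mfderiv (𝓡 2) 𝓘(ℝ, ℝ) u x v := by
  have : FiniteDimensional ℝ (TangentSpace (𝓡 2) x) :=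
    inferInstanceAs (FiniteDimensional ℝ Plane)
  have : CompleteSpace (TangentSpace (𝓡 2) x) := FiniteDimensional.complete ℝ _
  exact InnerProductSpace.toDual_symm_apply

/-- The Riemannian scalar product as a function of a base point and two vectors of the plane. -/
def innerAt (x : M) (v w : Plane) : ℝ :=
  inner ℝ (show TangentSpace (𝓡 2) x from v) (show TangentSpace (𝓡 2) x from w)

theorem innerAt_add_left (x : M) (v v' w : Plane) :
    innerAt x (v + v') w = innerAt x v w + innerAt x v' w :=
  inner_add_left (𝕜 := ℝ) (show TangentSpace (𝓡 2) x from v) (show TangentSpace (𝓡 2) x from v')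
    (show TangentSpace (𝓡 2) x from w)

theorem innerAt_add_right (x : M) (v v' w : Plane) :
    innerAt x w (v + v') = innerAt x w v + innerAt x w v' :=
  inner_add_right (𝕜 := ℝ) (show TangentSpace (𝓡 2) x from w) (show TangentSpace (𝓡 2) x from v)
    (show TangentSpace (𝓡 2) x from v')

theorem innerAt_smul_left (x : M) (a : ℝ) (v w : Plane) :
    innerAt x (a • v) w = a * innerAt x v w :=
  real_inner_smul_left (show TangentSpace (𝓡 2) x from v) (show TangentSpace (𝓡 2) x from w) a

theorem innerAt_smul_right (x : M) (a : ℝ) (v w : Plane) :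
    innerAt x v (a • w) = a * innerAt x v w :=
  real_inner_smul_right (show TangentSpace (𝓡 2) x from v) (show TangentSpace (𝓡 2) x from w) a

/-- How the determinant of the metric changes under a linear substitution. -/
theorem det_innerAt (x : M) (L : Plane →L[ℝ] Plane) (D : Plane →L[ℝ] Plane) :
    (Matrix.of fun i j : Fin 2 => innerAt x (L (D (EuclideanSpace.single i (1 : ℝ))))
      (L (D (EuclideanSpace.single j (1 : ℝ))))).det =
    D.det ^ 2 * (Matrix.of fun i j : Fin 2 => innerAt x (L (EuclideanSpace.single i (1 : ℝ)))
      (L (EuclideanSpace.single j (1 : ℝ)))).det := by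
  have hD : D.det = (LinearMap.toMatrix (EuclideanSpace.basisFun (Fin 2) ℝ).toBasis
      (EuclideanSpace.basisFun (Fin 2) ℝ).toBasis (D : Plane →ₗ[ℝ] Plane)).det := by
    rw [LinearMap.det_toMatrix]
  have hdec : ∀ v : Plane, v = v 0 • EuclideanSpace.single 0 (1 : ℝ)
      + v 1 • EuclideanSpace.single 1 (1 : ℝ) := by
    intro v
    ext i
    fin_cases i <;> simp
  rw [hD]
  simp only [Matrix.det_fin_two, Matrix.of_apply, LinearMap.toMatrix_apply]
  rw [hdec (D (EuclideanSpace.single 0 1)), hdec (D (EuclideanSpace.single 1 1))]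
  simp only [map_add, map_smul, innerAt_add_left, innerAt_add_right, innerAt_smul_left,
    innerAt_smul_right]
  simp [EuclideanSpace.basisFun_apply]
  ring

theorem metricMatrix_eq (e : OpenPartialHomeomorph M Plane) (y : Plane) :
    metricMatrix e y = Matrix.of fun i j : Fin 2 => innerAt (e.symm y)
      ((mfderiv (𝓡 2) (𝓡 2) e.symm y : Plane →L[ℝ] Plane) (EuclideanSpace.single i (1 : ℝ)))
      ((mfderiv (𝓡 2) (𝓡 2) e.symm y : Plane →L[ℝ] Plane) (EuclideanSpace.single j (1 : ℝ))) :=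
  rfl

theorem chartMeasure_apply [MeasurableSpace M] [BorelSpace M]
    (e : OpenPartialHomeomorph M Plane) {s : Set M}
    (hs : MeasurableSet s) :
    chartMeasure e s = ∫⁻ y in e.target ∩ e.symm ⁻¹' s, ENNReal.ofReal (density e y) := by
  have hm : AEMeasurable e.symm (volume.restrict e.target) :=
    e.continuousOn_symm.aemeasurable e.open_target.measurableSet
  have hm' := hm.mono_ac (withDensity_absolutelyContinuous _
    (fun y => ENNReal.ofReal (density e y)))
  have hn : NullMeasurableSet (e.symm ⁻¹' s) (volume.restrict e.target) :=
    hm.nullMeasurableSet_preimage hs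
  rw [chartMeasure, Measure.map_apply_of_aemeasurable hm' hs,
    withDensity_apply₀ _ hn, Measure.restrict_restrict₀ hn, Set.inter_comm]

theorem chartMeasure_source_compl [MeasurableSpace M] [BorelSpace M]
    (e : OpenPartialHomeomorph M Plane) :
    chartMeasure e e.sourceᶜ = 0 := by
  rw [chartMeasure_apply e e.open_source.measurableSet.compl]
  have : e.target ∩ e.symm ⁻¹' e.sourceᶜ = ∅ := by
    ext y
    simp only [Set.mem_inter_iff, Set.mem_preimage, Set.mem_compl_iff, Set.mem_empty_iff_false,
      iff_false, not_and, not_not]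
    exact fun hy => e.map_target hy
  rw [this, Measure.restrict_empty, lintegral_zero_measure]

section Charts

theorem density_eq {e e' : OpenPartialHomeomorph M Plane}
    (he : e ∈ IsManifold.maximalAtlas (𝓡 2) ∞ M) (he' : e' ∈ IsManifold.maximalAtlas (𝓡 2) ∞ M)
    {y : Plane} (hy : y ∈ e.target) (hy' : e.symm y ∈ e'.source) :
    HasFDerivAt (e' ∘ e.symm) (fderiv ℝ (e' ∘ e.symm) y) y ∧
    density e y = |(fderiv ℝ (e' ∘ e.symm) y).det| * density e' (e' (e.symm y)) := by
  have h1 : MDifferentiableAt (𝓡 2) (𝓡 2) e.symm y :=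
    ((contMDiffOn_symm_of_mem_maximalAtlas he).contMDiffAt
      (e.open_target.mem_nhds hy)).mdifferentiableAt (by simp)
  have h2 : MDifferentiableAt (𝓡 2) (𝓡 2) e' (e.symm y) :=
    ((contMDiffOn_of_mem_maximalAtlas he').contMDiffAt
      (e'.open_source.mem_nhds hy')).mdifferentiableAt (by simp)
  have h3 : MDifferentiableAt (𝓡 2) (𝓡 2) e'.symm (e' (e.symm y)) :=
    ((contMDiffOn_symm_of_mem_maximalAtlas he').contMDiffAt
      (e'.open_target.mem_nhds (e'.map_source hy'))).mdifferentiableAt (by simp)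
  have h21 : MDifferentiableAt (𝓡 2) (𝓡 2) (e' ∘ e.symm) y := h2.comp y h1
  refine ⟨(mdifferentiableAt_iff_differentiableAt.1 h21).hasFDerivAt, ?_⟩
  have heq : (e.symm : Plane → M) =ᶠ[nhds y] e'.symm ∘ (e' ∘ e.symm) := by
    have hc : ContinuousAt e.symm y := e.continuousAt_symm hy
    filter_upwards [hc.preimage_mem_nhds (e'.open_source.mem_nhds hy')] with z hz
    exact (e'.left_inv hz).symm
  have hpt : e'.symm (e' (e.symm y)) = e.symm y := e'.left_inv hy'
  have hder : (mfderiv (𝓡 2) (𝓡 2) e.symm y : Plane →L[ℝ] Plane) =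
      (mfderiv (𝓡 2) (𝓡 2) e'.symm (e' (e.symm y)) : Plane →L[ℝ] Plane).comp
        (fderiv ℝ (e' ∘ e.symm) y) := by
    have a : (mfderiv (𝓡 2) (𝓡 2) e.symm y : Plane →L[ℝ] Plane) =
      (mfderiv (𝓡 2) (𝓡 2) (e'.symm ∘ (e' ∘ e.symm)) y : Plane →L[ℝ] Plane) :=
        heq.mfderiv_eq
    rw [a, ← mfderiv_eq_fderiv]
    exact mfderiv_comp y h3 h21
  have hdet := det_innerAt (e.symm y)
    (mfderiv (𝓡 2) (𝓡 2) e'.symm (e' (e.symm y)) : Plane →L[ℝ] Plane) (fderiv ℝ (e' ∘ e.symm) y)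
  unfold density
  rw [metricMatrix_eq, metricMatrix_eq, hder, hpt, ← Real.sqrt_sq_eq_abs,
    ← Real.sqrt_mul (sq_nonneg _)]
  exact congrArg Real.sqrt hdet

variable [MeasurableSpace M] [BorelSpace M]

/-- The measures of two charts agree on the overlap of the charts. -/
theorem chartMeasure_eq {e e' : OpenPartialHomeomorph M Plane}
    (he : e ∈ IsManifold.maximalAtlas (𝓡 2) ∞ M) (he' : e' ∈ IsManifold.maximalAtlas (𝓡 2) ∞ M)
    {s : Set M} (hs : MeasurableSet s) (hse : s ⊆ e.source) (hse' : s ⊆ e'.source) :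
    chartMeasure e s = chartMeasure e' s := by
  rw [chartMeasure_apply e hs, chartMeasure_apply e' hs]
  have himg : e'.target ∩ e'.symm ⁻¹' s = (e' ∘ e.symm) '' (e.target ∩ e.symm ⁻¹' s) := by
    ext z
    constructor
    · rintro ⟨hz, hzs⟩
      refine ⟨e (e'.symm z), ⟨e.map_source (hse hzs), ?_⟩, ?_⟩
      · simpa [e.left_inv (hse hzs)] using hzs
      · simp [e.left_inv (hse hzs), e'.right_inv hz]
    · rintro ⟨y, ⟨hy, hys⟩, rfl⟩
      refine ⟨e'.map_source (hse' hys), ?_⟩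
      simpa [e'.left_inv (hse' hys)] using hys
  have hmeas : MeasurableSet (e.target ∩ e.symm ⁻¹' s) := by
    have := e.open_target.measurableSet.subtype_image
      ((continuousOn_iff_continuous_domRestrict.1 e.continuousOn_symm).measurable hs)
    rwa [Set.domRestrict_eq, Set.preimage_comp, Subtype.image_preimage_coe] at this
  have hinj : Set.InjOn (e' ∘ e.symm) (e.target ∩ e.symm ⁻¹' s) := by
    intro y hy z hz h
    exact e.symm.injOn hy.1 hz.1 (e'.injOn (hse' hy.2) (hse' hz.2) h)
  rw [himg, lintegral_image_eq_lintegral_abs_det_fderiv_mul volume hmeas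
    (fun y hy => (density_eq he he' hy.1 (hse' hy.2)).1.hasFDerivWithinAt) hinj]
  refine setLIntegral_congr_fun hmeas fun y hy => ?_
  rw [(density_eq he he' hy.1 (hse' hy.2)).2, ENNReal.ofReal_mul (abs_nonneg _)]
  rfl

/-- In the domain of every chart, the Riemannian volume is `√(det gᵢⱼ) dy`. -/
theorem vol_restrict_source [IsManifold (𝓡 2) ∞ M] (p : M) :
    (vol M).restrict (chartAt Plane p).source = chartMeasure (chartAt Plane p) := by
  set e := chartAt Plane p with he
  have hms : MeasurableSet e.source := e.open_source.measurableSet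
  have hmem : ∀ q : M, chartAt Plane q ∈ IsManifold.maximalAtlas (𝓡 2) ∞ M :=
    fun q => IsManifold.chart_mem_maximalAtlas q
  apply le_antisymm
  · have hle : vol M ≤ chartMeasure e + (⊤ : Measure M).restrict e.sourceᶜ := by
      refine iSup_le fun q => ?_
      rw [← Measure.restrict_add_restrict_compl (μ := chartMeasure (chartAt Plane q)) hms]
      refine add_le_add ?_ (Measure.restrict_mono le_rfl le_top)
      refine Measure.le_iff.2 fun s hs => ?_
      rw [Measure.restrict_apply hs]
      have hq : (chartAt Plane q).source ∈ {u : Set M | MeasurableSet u} :=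
        (chartAt Plane q).open_source.measurableSet
      have h0 : chartMeasure (chartAt Plane q) (s ∩ e.source) =
          chartMeasure (chartAt Plane q) (s ∩ e.source ∩ (chartAt Plane q).source) := by
        exact (measure_inter_conull (chartMeasure_source_compl (chartAt Plane q))).symm
      rw [h0, chartMeasure_eq (hmem q) (hmem p) ((hs.inter hms).inter hq)
        Set.inter_subset_right (fun x hx => hx.1.2)]
      exact measure_mono (fun x hx => hx.1.1)
    refine (Measure.restrict_mono le_rfl hle).trans ?_
    rw [Measure.restrict_add, Measure.restrict_restrict hms, Set.inter_compl_self,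
      Measure.restrict_empty, add_zero]
    exact Measure.restrict_le_self
  · rw [← Measure.restrict_eq_self_of_ae_mem (μ := chartMeasure e) (s := e.source)
      (measure_eq_zero_iff_ae_notMem.1 (chartMeasure_source_compl e) |>.mono fun x hx => by
        simpa using hx)]
    exact Measure.restrict_mono le_rfl (le_iSup (fun q : M => chartMeasure (chartAt Plane q)) p)

end Charts

end Metric

/-! ### Test functions, weak gradients, weights and the first Dirichlet eigenvalue -/

/-- `u ∈ C_c^∞(Ω)`. -/
structure IsTestFunction (Ω : Set M) (u : M → ℝ) : Prop where
  smooth : ContMDiff (𝓡 2) 𝓘(ℝ, ℝ) ∞ u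
  compact : HasCompactSupport u
  support_subset : tsupport u ⊆ Ω

/-- `Y` is a smooth vector field with compact support in `Ω`. -/
structure IsTestField [IsManifold (𝓡 2) ∞ M] (Ω : Set M)
    (Y : Π x : M, TangentSpace (𝓡 2) x) : Prop where
  smooth : ContMDiff (𝓡 2) (𝓡 2).tangent ∞ (fun x => (⟨x, Y x⟩ : TangentBundle (𝓡 2) M))
  compact : ∃ K : Set M, IsCompact K ∧ K ⊆ Ω ∧ ∀ x ∉ K, Y x = 0

variable [RiemannianBundle (fun x : M => TangentSpace (𝓡 2) x)] [MeasurableSpace M]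

/-- `u ∈ W^{1,2}_loc(Ω)`, with weak gradient `X`: both are locally square integrable in `Ω`, and
`∫ u div Y = - ∫ ⟨X, Y⟩` for all smooth vector fields `Y` with compact support in `Ω`.
(The integrability of all `⟨X, Y⟩` expresses the measurability of `X`.) -/
structure HasWeakGradient [IsManifold (𝓡 2) ∞ M] (Ω : Set M) (u : M → ℝ)
    (X : Π x : M, TangentSpace (𝓡 2) x) : Prop where
  aestronglyMeasurable : AEStronglyMeasurable u ((vol M).restrict Ω)
  sq_integrable : LocallyIntegrableOn (fun x => u x ^ 2) Ω (vol M)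
  sq_integrable_gradient : LocallyIntegrableOn (fun x => ‖X x‖ ^ 2) Ω (vol M)
  integrable_inner : ∀ Y, IsTestField Ω Y →
    IntegrableOn (fun x => (inner ℝ (X x) (Y x) : ℝ)) Ω (vol M)
  integral_eq : ∀ Y, IsTestField Ω Y →
    ∫ x in Ω, u x * divergence Y x ∂(vol M) = - ∫ x in Ω, (inner ℝ (X x) (Y x) : ℝ) ∂(vol M)

/-- `w` is a positive weight in `W^{1,2}_loc(Ω)`, with weak gradient `X = ∇w`, that satisfies
`w² Δ_g ln w = -κ w²` weakly in `Ω`: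
`∫ (4|∇w|² - 2κw²) φ - w² Δ_g φ = 0` for all `φ ∈ C_c^∞(Ω)`. -/
structure IsWeight [IsManifold (𝓡 2) ∞ M] (Ω : Set M) (κ w : M → ℝ)
    (X : Π x : M, TangentSpace (𝓡 2) x) : Prop where
  pos : ∀ᵐ x ∂((vol M).restrict Ω), 0 < w x
  hasWeakGradient : HasWeakGradient Ω w X
  integrable_curvature : LocallyIntegrableOn (fun x => κ x * w x ^ 2) Ω (vol M)
  weak_equation : ∀ φ, IsTestFunction Ω φ →
    ∫ x in Ω, ((4 * ‖X x‖ ^ 2 - 2 * κ x * w x ^ 2) * φ x - w x ^ 2 * laplacian φ x) ∂(vol M) = 0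

/-- The first Dirichlet eigenvalue of `-Δ_g` on `Ω`: the infimum of the Rayleigh quotients
`∫ |∇u|² / ∫ u²` over the nonzero `u ∈ C_c^∞(Ω)`. -/
def firstDirichletEigenvalue (Ω : Set M) : ℝ :=
  sInf {r : ℝ | ∃ u : M → ℝ, IsTestFunction Ω u ∧ u ≠ 0 ∧
    r = (∫ x in Ω, ‖grad u x‖ ^ 2 ∂(vol M)) / ∫ x in Ω, u x ^ 2 ∂(vol M)}

end Riemannian

end WeightedCKN

end

noncomputable section

namespace WeightedCKN

variable {M : Type*} [TopologicalSpace M] [ChartedSpace Plane M]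

/-! ### Linear algebra of frames of a Euclidean plane -/

section Frame

variable {V : Type*} [NormedAddCommGroup V] [InnerProductSpace ℝ V] {b₀ b₁ v : V} {s t : ℝ}

/-! Write A = ∫|∇ω|²f², B = ∫κω²f², C = ∫ωf⟨∇ω,∇f⟩ and E = ∫ω²|∇f|². The weak equation tested with φ
= f² reads 4A − 2B − ∫ω²Δ(f²) = 0. Integration by parts gives ∫ω²Δ(f²) = −2∫ω⟨∇ω,∇(f²)⟩ = −4C, hence
B = 2A + 2C. The function fω is an admissible competitor for λ₁(Ω), so λ₁∫f²ω² ≤ ∫|∇(fω)|² = A + 2C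
+ E. Since κ ≤ λ₁, the left side is at least B. Therefore 2A + 2C ≤ A + 2C + E. The cross term C
cancels and A ≤ E remains.

This algebra is `IsWeight.integral_sq_mul_le`. Two facts about the merely Sobolev function ω support
it: the Rayleigh bound for fω (`HasWeakGradient.firstDirichletEigenvalue_mul_le`) and ∫ω² div Y =
−2∫ω⟨∇ω,Y⟩ (`HasWeakGradient.integral_sq_mul_divergence`).

Both facts follow from density (`HasWeakGradient.isApproximable`): for a test function ψ, the
product ψω is a limit of test functions in L², together with gradients. A partition of unity reduces
this to one chart. There the intrinsic weak gradient becomes a pair of weak partial derivatives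
(`HasWeakGradient.integral_chart_eq`), and mollification in the plane applies
(`exists_contDiff_approx`). Compact sets in a chart carry comparable Lebesgue and Riemannian
measures, and comparable norms, so the approximation transfers back to the surface. The passage to
charts rests on the chart independence of the divergence (`divergence_eq_chartDivergence`), which is
the Piola identity. -/

theorem gram_mul_fst (hv : v = s • b₀ + t • b₁) :
    (inner ℝ b₀ b₀ * inner ℝ b₁ b₁ - inner ℝ b₀ b₁ * inner ℝ b₁ b₀) * s =
      inner ℝ b₁ b₁ * inner ℝ v b₀ - inner ℝ b₀ b₁ * inner ℝ v b₁ := by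
  subst hv
  simp only [inner_add_left, real_inner_smul_left, real_inner_comm b₀ b₁]
  ring

theorem gram_mul_snd (hv : v = s • b₀ + t • b₁) :
    (inner ℝ b₀ b₀ * inner ℝ b₁ b₁ - inner ℝ b₀ b₁ * inner ℝ b₁ b₀) * t =
      inner ℝ b₀ b₀ * inner ℝ v b₁ - inner ℝ b₀ b₁ * inner ℝ v b₀ := by
  subst hv
  simp only [inner_add_left, real_inner_smul_left, real_inner_comm b₀ b₁]
  ring

/-- Let G be the Gram matrix and a = (⟨v,b₀⟩, ⟨v,b₁⟩). By Cramer's rule det G · |v|² = aᵀ adj(G) a,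
and adj(G) = tr(G) I − G for 2 × 2 matrices. The discarded term aᵀGa = |a₀b₀ + a₁b₁|² is
nonnegative. -/
theorem gram_mul_norm_sq_le (hv : v = s • b₀ + t • b₁) :
    (inner ℝ b₀ b₀ * inner ℝ b₁ b₁ - inner ℝ b₀ b₁ * inner ℝ b₁ b₀) * ‖v‖ ^ 2 ≤
      (inner ℝ b₀ b₀ + inner ℝ b₁ b₁) * ((inner ℝ v b₀ : ℝ) ^ 2 + (inner ℝ v b₁ : ℝ) ^ 2) := by
  have h1 := gram_mul_fst hv
  have h2 := gram_mul_snd hv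
  have h3 : ‖v‖ ^ 2 = s * inner ℝ v b₀ + t * inner ℝ v b₁ := by
    rw [← real_inner_self_eq_norm_sq]
    nth_rewrite 2 [hv]
    simp only [inner_add_right, real_inner_smul_right]
  have h4 : 0 ≤ ‖(inner ℝ v b₀ : ℝ) • b₀ + (inner ℝ v b₁ : ℝ) • b₁‖ ^ 2 := sq_nonneg _
  rw [← real_inner_self_eq_norm_sq] at h4
  simp only [inner_add_left, inner_add_right, real_inner_smul_left, real_inner_smul_right] at h4
  have h5 : (inner ℝ b₀ b₀ * inner ℝ b₁ b₁ - inner ℝ b₀ b₁ * inner ℝ b₁ b₀) * ‖v‖ ^ 2 =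
      (inner ℝ b₁ b₁ * inner ℝ v b₀ - inner ℝ b₀ b₁ * inner ℝ v b₁) * inner ℝ v b₀ +
      (inner ℝ b₀ b₀ * inner ℝ v b₁ - inner ℝ b₀ b₁ * inner ℝ v b₀) * inner ℝ v b₁ := by
    rw [h3, ← h1, ← h2]
    ring
  rw [h5]
  rw [real_inner_comm b₀ b₁] at *
  nlinarith [h4]

/-- The vector −⟨b₀,b₁⟩b₀ + |b₀|²b₁ is |b₀|² times the part of b₁ orthogonal to b₀, and its squared
norm is |b₀|² times the Gram determinant. Independence makes it nonzero. -/
theorem gram_pos (h : ∀ s t : ℝ, s • b₀ + t • b₁ = 0 → s = 0 ∧ t = 0) :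
    0 < (inner ℝ b₀ b₀ * inner ℝ b₁ b₁ - inner ℝ b₀ b₁ * inner ℝ b₁ b₀ : ℝ) := by
  have h0 : b₀ ≠ 0 := fun h0 => one_ne_zero (h 1 0 (by simp [h0])).1
  have h00 : (0 : ℝ) < inner ℝ b₀ b₀ := real_inner_self_pos.2 h0
  have h1 : (-(inner ℝ b₀ b₁ : ℝ)) • b₀ + (inner ℝ b₀ b₀ : ℝ) • b₁ ≠ 0 :=
    fun h2 => h00.ne' (h _ _ h2).2
  have h2 := real_inner_self_pos.2 h1
  simp only [inner_add_left, inner_add_right, real_inner_smul_left, real_inner_smul_right] at h2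
  rw [real_inner_comm b₀ b₁] at *
  have h3 : 0 < inner ℝ b₀ b₀ *
      (inner ℝ b₀ b₀ * inner ℝ b₁ b₁ - inner ℝ b₀ b₁ * inner ℝ b₀ b₁ : ℝ) := by
    nlinarith [h2]
  exact pos_of_mul_pos_right h3 h00.le

end Frame

/-! ### Smoothness of the coordinate fields and of the metric -/

theorem plane_eq_sum (v : Plane) :
    v = v 0 • EuclideanSpace.single 0 (1 : ℝ) + v 1 • EuclideanSpace.single 1 (1 : ℝ) := by
  ext i
  fin_cases i <;> simp

variable {e : OpenPartialHomeomorph M Plane}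

/-- The coordinate field is the tangent map of `e.symm` applied to a constant section of the tangent
bundle of the plane, and tangent maps of smooth maps are smooth. -/
theorem contMDiffOn_coordField [IsManifold (𝓡 2) ∞ M]
    (he : e ∈ IsManifold.maximalAtlas (𝓡 2) ∞ M) (i : Fin 2) :
    ContMDiffOn (𝓡 2) (𝓡 2).tangent ∞
      (fun y => (⟨e.symm y, coordField e i y⟩ : TangentBundle (𝓡 2) M)) e.target := by
  have h1 := (contMDiffOn_symm_of_mem_maximalAtlas he).contMDiffOn_tangentMapWithin
    (m := ∞) (by simp) e.open_target.uniqueMDiffOn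
  have h2 : ContMDiff (𝓡 2) (𝓡 2).tangent ∞
      (fun y : Plane => (⟨y, (EuclideanSpace.single i (1 : ℝ) : Plane)⟩ :
        TangentBundle (𝓡 2) Plane)) := by
    intro y
    refine (contMDiffAt_section (F := Plane) (E := TangentSpace (𝓡 2)) y).2 ?_
    simpa using contMDiffAt_const
  refine (h1.comp h2.contMDiffOn (fun y hy => hy)).congr fun y hy => ?_
  simp only [Function.comp, tangentMapWithin, coordField]
  rw [mfderivWithin_of_isOpen e.open_target hy]

/-- The differential of the chart `e`, as a linear map of the plane. -/
def fwdDeriv (e : OpenPartialHomeomorph M Plane) (x : M) : Plane →L[ℝ] Plane :=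
  mfderiv (𝓡 2) (𝓡 2) e x

/-- The differential of the inverse of the chart `e`, as a linear map of the plane. -/
def bwdDeriv (e : OpenPartialHomeomorph M Plane) (x : M) : Plane →L[ℝ] Plane :=
  mfderiv (𝓡 2) (𝓡 2) e.symm (e x)

theorem bwdDeriv_fwdDeriv (he : e ∈ IsManifold.maximalAtlas (𝓡 2) ∞ M) {x : M}
    (hx : x ∈ e.source) (v : Plane) : bwdDeriv e x (fwdDeriv e x v) = v := by
  have h1 : MDifferentiableAt (𝓡 2) (𝓡 2) e x :=
    (contMDiffAt_of_mem_maximalAtlas he hx).mdifferentiableAt (by simp)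
  have h2 : MDifferentiableAt (𝓡 2) (𝓡 2) e.symm (e x) :=
    (contMDiffAt_symm_of_mem_maximalAtlas he (e.map_source hx)).mdifferentiableAt (by simp)
  have h3 : e.symm ∘ e =ᶠ[nhds x] id := by
    filter_upwards [e.open_source.mem_nhds hx] with z hz using e.left_inv hz
  have h4 := mfderiv_comp x h2 h1
  rw [h3.mfderiv_eq, mfderiv_id] at h4
  exact (DFunLike.congr_fun h4 v).symm

theorem fwdDeriv_bwdDeriv (he : e ∈ IsManifold.maximalAtlas (𝓡 2) ∞ M) {x : M}
    (hx : x ∈ e.source) (v : Plane) : fwdDeriv e x (bwdDeriv e x v) = v := by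
  have h1 : MDifferentiableAt (𝓡 2) (𝓡 2) e (e.symm (e x)) := by
    rw [e.left_inv hx]
    exact (contMDiffAt_of_mem_maximalAtlas he hx).mdifferentiableAt (by simp)
  have h2 : MDifferentiableAt (𝓡 2) (𝓡 2) e.symm (e x) :=
    (contMDiffAt_symm_of_mem_maximalAtlas he (e.map_source hx)).mdifferentiableAt (by simp)
  have h3 : e ∘ e.symm =ᶠ[nhds (e x)] id := by
    filter_upwards [e.open_target.mem_nhds (e.map_source hx)] with z hz using e.right_inv hz
  have h4 := mfderiv_comp (e x) h1 h2
  rw [h3.mfderiv_eq, mfderiv_id, e.left_inv hx] at h4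
  exact (DFunLike.congr_fun h4 v).symm

/-- The coordinate vector field `∂ᵢ` of the chart `e`, as a vector field on `M`. -/
def frame (e : OpenPartialHomeomorph M Plane) (i : Fin 2) (x : M) : TangentSpace (𝓡 2) x :=
  bwdDeriv e x (EuclideanSpace.single i (1 : ℝ))

/-- All tangent spaces are the same type `Plane`, so a vector can be kept fixed while its base point
is rewritten. This is needed because `frame` at `x` is `coordField` at `e x`, whose base point is
`e.symm (e x)`. -/
theorem tangentBundle_mk_congr {x x' : M} (h : x = x') (v : Plane) :
    (⟨x, v⟩ : TangentBundle (𝓡 2) M) = ⟨x', v⟩ := by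
  subst h
  rfl

theorem contMDiffOn_frame [IsManifold (𝓡 2) ∞ M]
    (he : e ∈ IsManifold.maximalAtlas (𝓡 2) ∞ M) (i : Fin 2) :
    ContMDiffOn (𝓡 2) (𝓡 2).tangent ∞
      (fun x => (⟨x, frame e i x⟩ : TangentBundle (𝓡 2) M)) e.source :=
  ((contMDiffOn_coordField he i).comp (contMDiffOn_of_mem_maximalAtlas he)
    fun _ hx => e.map_source hx).congr fun _ hx => tangentBundle_mk_congr (e.left_inv hx).symm _

theorem contMDiffAt_frame [IsManifold (𝓡 2) ∞ M]
    (he : e ∈ IsManifold.maximalAtlas (𝓡 2) ∞ M) {x : M}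
    (hx : x ∈ e.source) (i : Fin 2) :
    ContMDiffAt (𝓡 2) (𝓡 2).tangent ∞
      (fun x => (⟨x, frame e i x⟩ : TangentBundle (𝓡 2) M)) x :=
  (contMDiffOn_frame he i).contMDiffAt (e.open_source.mem_nhds hx)

theorem eq_sum_component (he : e ∈ IsManifold.maximalAtlas (𝓡 2) ∞ M) {x : M} (hx : x ∈ e.source)
    (Y : Π x : M, TangentSpace (𝓡 2) x) :
    Y x = component e Y 0 (e x) • frame e 0 x + component e Y 1 (e x) • frame e 1 x := by
  have h1 := bwdDeriv_fwdDeriv he hx (Y x)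
  rw [plane_eq_sum (fwdDeriv e x (Y x)), map_add, map_smul, map_smul] at h1
  have h2 : ∀ i, component e Y i (e x) = fwdDeriv e x (Y x) i := by
    intro i
    unfold component
    rw [e.left_inv hx]
    rfl
  rw [h2, h2]
  exact h1.symm

theorem frame_independent (he : e ∈ IsManifold.maximalAtlas (𝓡 2) ∞ M) {x : M} (hx : x ∈ e.source)
    (s t : ℝ) (h : s • frame e 0 x + t • frame e 1 x = 0) : s = 0 ∧ t = 0 := by
  have h2 := fwdDeriv_bwdDeriv he hx
    (s • EuclideanSpace.single 0 (1 : ℝ) + t • EuclideanSpace.single 1 (1 : ℝ))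
  rw [map_add (bwdDeriv e x), map_smul, map_smul] at h2
  have h3 : (0 : Plane) =
      s • EuclideanSpace.single 0 (1 : ℝ) + t • EuclideanSpace.single 1 (1 : ℝ) :=
    (map_zero (fwdDeriv e x)).symm.trans ((congrArg (fwdDeriv e x) h).symm.trans h2)
  constructor
  · simpa using (congrArg (fun v : Plane => v 0) h3).symm
  · simpa using (congrArg (fun v : Plane => v 1) h3).symm

theorem mfderiv_frame (he : e ∈ IsManifold.maximalAtlas (𝓡 2) ∞ M) {x : M} (hx : x ∈ e.source)
    {u : M → ℝ} (hu : MDifferentiableAt (𝓡 2) 𝓘(ℝ, ℝ) u x) (i : Fin 2) :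
    mfderiv (𝓡 2) 𝓘(ℝ, ℝ) u x (frame e i x) =
      fderiv ℝ (u ∘ e.symm) (e x) (EuclideanSpace.single i (1 : ℝ)) := by
  have h2 : MDifferentiableAt (𝓡 2) (𝓡 2) e.symm (e x) :=
    (contMDiffAt_symm_of_mem_maximalAtlas he (e.map_source hx)).mdifferentiableAt (by simp)
  have hu' : MDifferentiableAt (𝓡 2) 𝓘(ℝ, ℝ) u (e.symm (e x)) := by rwa [e.left_inv hx]
  have h3 := mfderiv_comp (e x) hu' h2
  rw [mfderiv_eq_fderiv, e.left_inv hx] at h3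
  rw [h3]
  rfl

/-- Transfer of smoothness from the manifold to a chart. -/
theorem contDiffAt_of_contMDiffAt (he : e ∈ IsManifold.maximalAtlas (𝓡 2) ∞ M) {y : Plane}
    (hy : y ∈ e.target) {h : M → ℝ} (hh : ContMDiffAt (𝓡 2) 𝓘(ℝ, ℝ) ∞ h (e.symm y)) :
    ContDiffAt ℝ ∞ (h ∘ e.symm) y :=
  (hh.comp y (contMDiffAt_symm_of_mem_maximalAtlas he hy)).contDiffAt

theorem contDiffAt_of_contMDiffAt' (he : e ∈ IsManifold.maximalAtlas (𝓡 2) ∞ M) {y : Plane}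
    (hy : y ∈ e.target) {h : Plane → ℝ}
    (hh : ContMDiffAt (𝓡 2) 𝓘(ℝ, ℝ) ∞ (fun x => h (e x)) (e.symm y)) :
    ContDiffAt ℝ ∞ h y := by
  refine (contDiffAt_of_contMDiffAt he hy hh).congr_of_eventuallyEq ?_
  filter_upwards [e.open_target.mem_nhds hy] with z hz
  simp [e.right_inv hz]

/-! ### The Gram matrix of the coordinate frame, components of fields, smoothness of gradients. -/

section Metric

variable [RiemannianBundle (fun x : M => TangentSpace (𝓡 2) x)]

theorem metricMatrix_apply {x : M} (hx : x ∈ e.source) (i j : Fin 2) :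
    metricMatrix e (e x) i j = inner ℝ (frame e i x) (frame e j x) := by
  rw [metricMatrix_eq, e.left_inv hx]
  rfl

theorem det_metricMatrix {x : M} (hx : x ∈ e.source) :
    (metricMatrix e (e x)).det =
      inner ℝ (frame e 0 x) (frame e 0 x) * inner ℝ (frame e 1 x) (frame e 1 x) -
      inner ℝ (frame e 0 x) (frame e 1 x) * inner ℝ (frame e 1 x) (frame e 0 x) := by
  rw [Matrix.det_fin_two]
  simp only [metricMatrix_apply hx]

theorem det_metricMatrix_pos (he : e ∈ IsManifold.maximalAtlas (𝓡 2) ∞ M) {x : M}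
    (hx : x ∈ e.source) : 0 < (metricMatrix e (e x)).det := by
  rw [det_metricMatrix hx]
  exact gram_pos (frame_independent he hx)

theorem density_pos (he : e ∈ IsManifold.maximalAtlas (𝓡 2) ∞ M) {y : Plane}
    (hy : y ∈ e.target) : 0 < density e y := by
  have h := det_metricMatrix_pos he (e.map_target hy)
  rw [e.right_inv hy] at h
  exact Real.sqrt_pos.2 h

theorem component_zero_eq (he : e ∈ IsManifold.maximalAtlas (𝓡 2) ∞ M) {x : M} (hx : x ∈ e.source)
    (Y : Π x : M, TangentSpace (𝓡 2) x) :
    component e Y 0 (e x) = ((metricMatrix e (e x)).det)⁻¹ *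
      (inner ℝ (frame e 1 x) (frame e 1 x) * inner ℝ (Y x) (frame e 0 x) -
        inner ℝ (frame e 0 x) (frame e 1 x) * inner ℝ (Y x) (frame e 1 x)) := by
  rw [eq_inv_mul_iff_mul_eq₀ (det_metricMatrix_pos he hx).ne', det_metricMatrix hx]
  exact gram_mul_fst (eq_sum_component he hx Y)

theorem component_one_eq (he : e ∈ IsManifold.maximalAtlas (𝓡 2) ∞ M) {x : M} (hx : x ∈ e.source)
    (Y : Π x : M, TangentSpace (𝓡 2) x) :
    component e Y 1 (e x) = ((metricMatrix e (e x)).det)⁻¹ *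
      (inner ℝ (frame e 0 x) (frame e 0 x) * inner ℝ (Y x) (frame e 1 x) -
        inner ℝ (frame e 0 x) (frame e 1 x) * inner ℝ (Y x) (frame e 0 x)) := by
  rw [eq_inv_mul_iff_mul_eq₀ (det_metricMatrix_pos he hx).ne', det_metricMatrix hx]
  exact gram_mul_snd (eq_sum_component he hx Y)

theorem det_mul_norm_sq_le (he : e ∈ IsManifold.maximalAtlas (𝓡 2) ∞ M) {x : M}
    (hx : x ∈ e.source) (Y : Π x : M, TangentSpace (𝓡 2) x) :
    (metricMatrix e (e x)).det * ‖Y x‖ ^ 2 ≤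
      (metricMatrix e (e x)).trace *
        ((inner ℝ (Y x) (frame e 0 x) : ℝ) ^ 2 + (inner ℝ (Y x) (frame e 1 x) : ℝ) ^ 2) := by
  rw [det_metricMatrix hx, Matrix.trace_fin_two, metricMatrix_apply hx, metricMatrix_apply hx]
  exact gram_mul_norm_sq_le (eq_sum_component he hx Y)

theorem inner_grad_frame (he : e ∈ IsManifold.maximalAtlas (𝓡 2) ∞ M) {x : M} (hx : x ∈ e.source)
    {u : M → ℝ} (hu : MDifferentiableAt (𝓡 2) 𝓘(ℝ, ℝ) u x) (i : Fin 2) :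
    (inner ℝ (grad u x) (frame e i x) : ℝ) =
      fderiv ℝ (u ∘ e.symm) (e x) (EuclideanSpace.single i (1 : ℝ)) := by
  rw [inner_grad, mfderiv_frame he hx hu]

variable [IsManifold (𝓡 2) ∞ M]
  [IsContMDiffRiemannianBundle (𝓡 2) ∞ Plane (fun x : M => TangentSpace (𝓡 2) x)]

theorem contMDiffAt_inner {X Y : Π x : M, TangentSpace (𝓡 2) x} {x : M}
    (hX : ContMDiffAt (𝓡 2) (𝓡 2).tangent ∞
      (fun x => (⟨x, X x⟩ : TangentBundle (𝓡 2) M)) x)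
    (hY : ContMDiffAt (𝓡 2) (𝓡 2).tangent ∞
      (fun x => (⟨x, Y x⟩ : TangentBundle (𝓡 2) M)) x) :
    ContMDiffAt (𝓡 2) 𝓘(ℝ, ℝ) ∞ (fun x => (inner ℝ (X x) (Y x) : ℝ)) x :=
  ContMDiffAt.inner_bundle (F := Plane) (E := fun x : M => TangentSpace (𝓡 2) x) hX hY

theorem contMDiffAt_inner_frame (he : e ∈ IsManifold.maximalAtlas (𝓡 2) ∞ M)
    {Y : Π x : M, TangentSpace (𝓡 2) x} {x : M} (hx : x ∈ e.source)
    (hY : ContMDiffAt (𝓡 2) (𝓡 2).tangent ∞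
      (fun x => (⟨x, Y x⟩ : TangentBundle (𝓡 2) M)) x) (i : Fin 2) :
    ContMDiffAt (𝓡 2) 𝓘(ℝ, ℝ) ∞ (fun x => (inner ℝ (Y x) (frame e i x) : ℝ)) x :=
  contMDiffAt_inner hY (contMDiffAt_frame he hx i)

theorem contMDiffAt_det (he : e ∈ IsManifold.maximalAtlas (𝓡 2) ∞ M) {x : M}
    (hx : x ∈ e.source) :
    ContMDiffAt (𝓡 2) 𝓘(ℝ, ℝ) ∞ (fun x => (metricMatrix e (e x)).det) x := by
  have h := fun i j => contMDiffAt_inner_frame he hx (contMDiffAt_frame he hx i) j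
  refine (((h 0 0).mul (h 1 1)).sub ((h 0 1).mul (h 1 0))).congr_of_eventuallyEq ?_
  filter_upwards [e.open_source.mem_nhds hx] with z hz
  rw [det_metricMatrix hz]
  rfl

theorem contDiffAt_metricMatrix (he : e ∈ IsManifold.maximalAtlas (𝓡 2) ∞ M) {y : Plane}
    (hy : y ∈ e.target) (i j : Fin 2) : ContDiffAt ℝ ∞ (fun y => metricMatrix e y i j) y := by
  refine contDiffAt_of_contMDiffAt' he hy ?_
  have hx := e.map_target hy
  refine (contMDiffAt_inner_frame he hx (contMDiffAt_frame he hx i) j).congr_of_eventuallyEq ?_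
  filter_upwards [e.open_source.mem_nhds hx] with z hz using metricMatrix_apply hz i j

theorem contDiffAt_density (he : e ∈ IsManifold.maximalAtlas (𝓡 2) ∞ M) {y : Plane}
    (hy : y ∈ e.target) : ContDiffAt ℝ ∞ (density e) y := by
  have h := det_metricMatrix_pos he (e.map_target hy)
  rw [e.right_inv hy] at h
  exact (contDiffAt_of_contMDiffAt' he hy (contMDiffAt_det he (e.map_target hy))).sqrt h.ne'

/-- Cramer's rule expresses the components through the scalar products with the frame. Only these
products are assumed smooth, so that the lemma applies to gradients before their smoothness as
sections is known. -/
theorem contMDiffAt_component (he : e ∈ IsManifold.maximalAtlas (𝓡 2) ∞ M)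
    {Y : Π x : M, TangentSpace (𝓡 2) x} {x : M} (hx : x ∈ e.source)
    (hY : ∀ i, ContMDiffAt (𝓡 2) 𝓘(ℝ, ℝ) ∞ (fun x => (inner ℝ (Y x) (frame e i x) : ℝ)) x)
    (i : Fin 2) :
    ContMDiffAt (𝓡 2) 𝓘(ℝ, ℝ) ∞ (fun x => component e Y i (e x)) x := by
  have h := fun i j => contMDiffAt_inner_frame he hx (contMDiffAt_frame he hx i) j
  have hd := (contMDiffAt_det he hx).inv₀ (det_metricMatrix_pos he hx).ne'
  have hs : ∀ᶠ z in nhds x, z ∈ e.source := e.open_source.mem_nhds hx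
  fin_cases i
  · refine (hd.mul (((h 1 1).mul (hY 0)).sub ((h 0 1).mul (hY 1)))).congr_of_eventuallyEq ?_
    filter_upwards [hs] with z hz using component_zero_eq he hz Y
  · refine (hd.mul (((h 0 0).mul (hY 1)).sub ((h 0 1).mul (hY 0)))).congr_of_eventuallyEq ?_
    filter_upwards [hs] with z hz using component_one_eq he hz Y

theorem contDiffAt_component (he : e ∈ IsManifold.maximalAtlas (𝓡 2) ∞ M)
    {Y : Π x : M, TangentSpace (𝓡 2) x} {y : Plane} (hy : y ∈ e.target)
    (hY : ContMDiffAt (𝓡 2) (𝓡 2).tangent ∞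
      (fun x => (⟨x, Y x⟩ : TangentBundle (𝓡 2) M)) (e.symm y)) (i : Fin 2) :
    ContDiffAt ℝ ∞ (component e Y i) y :=
  contDiffAt_of_contMDiffAt' he hy (contMDiffAt_component he (e.map_target hy)
    (contMDiffAt_inner_frame he (e.map_target hy) hY) i)

/-- The products ⟨∇u, ∂ᵢ⟩ are the partial derivatives of u, hence smooth. Cramer's rule makes the
components smooth, and ∇u is rebuilt from them and the frame. -/
theorem contMDiff_grad {u : M → ℝ}
    (hu : ContMDiff (𝓡 2) 𝓘(ℝ, ℝ) ∞ u) :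
    ContMDiff (𝓡 2) (𝓡 2).tangent ∞
      (fun x => (⟨x, grad u x⟩ : TangentBundle (𝓡 2) M)) := by
  intro x
  set e := chartAt Plane x
  have he : e ∈ IsManifold.maximalAtlas (𝓡 2) ∞ M := IsManifold.chart_mem_maximalAtlas x
  have hx : x ∈ e.source := mem_chart_source Plane x
  have hi : ∀ i, ContMDiffAt (𝓡 2) 𝓘(ℝ, ℝ) ∞
      (fun x => (inner ℝ (grad u x) (frame e i x) : ℝ)) x := by
    intro i
    have h1 : ContDiffAt ℝ ∞ (u ∘ e.symm) (e x) :=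
      contDiffAt_of_contMDiffAt he (e.map_source hx) hu.contMDiffAt
    have h2 : ContDiffAt ℝ ∞
        (fun y => fderiv ℝ (u ∘ e.symm) y (EuclideanSpace.single i (1 : ℝ))) (e x) :=
      (h1.fderiv_right (by simp)).clm_apply contDiffAt_const
    refine (h2.contMDiffAt.comp x (contMDiffAt_of_mem_maximalAtlas he hx)).congr_of_eventuallyEq ?_
    filter_upwards [e.open_source.mem_nhds hx] with z hz
    exact inner_grad_frame he hz (hu.mdifferentiableAt (by simp)) i
  have h := (((contMDiffAt_component he hx hi 0).smul_section (contMDiffAt_frame he hx 0)).add_section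
    ((contMDiffAt_component he hx hi 1).smul_section (contMDiffAt_frame he hx 1)))
  refine h.congr_of_eventuallyEq ?_
  filter_upwards [e.open_source.mem_nhds hx] with z hz
  exact congrArg (TotalSpace.mk z) (eq_sum_component he hz (grad u))

end Metric

end WeightedCKN

namespace WeightedCKN

variable {M : Type*} [TopologicalSpace M] [ChartedSpace Plane M]

/-! ### The divergence does not depend on the chart -/

theorem sum_apply_eq {E : Type*} [AddCommGroup E] [Module ℝ E] [TopologicalSpace E]
    (L : Plane →L[ℝ] E) (v : Plane) :
    L v = v 0 • L (EuclideanSpace.single 0 (1 : ℝ)) + v 1 • L (EuclideanSpace.single 1 (1 : ℝ)) := by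
  nth_rewrite 1 [plane_eq_sum v]
  rw [map_add, map_smul, map_smul]

theorem det_plane (D : Plane →L[ℝ] Plane) :
    D.det = D (EuclideanSpace.single 0 (1 : ℝ)) 0 * D (EuclideanSpace.single 1 (1 : ℝ)) 1 -
      D (EuclideanSpace.single 1 (1 : ℝ)) 0 * D (EuclideanSpace.single 0 (1 : ℝ)) 1 := by
  have hD : D.det = (LinearMap.toMatrix (EuclideanSpace.basisFun (Fin 2) ℝ).toBasis
      (EuclideanSpace.basisFun (Fin 2) ℝ).toBasis (D : Plane →ₗ[ℝ] Plane)).det := by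
    rw [LinearMap.det_toMatrix]
  rw [hD, Matrix.det_fin_two]
  simp [LinearMap.toMatrix_apply]

/-- The Piola identity in the plane: the divergence of the Piola transform
`adj(DF) (W ∘ F)` is `det(DF) (div W) ∘ F`. -/
theorem piola {F : Plane → Plane} {W : Fin 2 → Plane → ℝ} {z : Plane} (hF : ContDiffAt ℝ ∞ F z)
    (hW : ∀ i, DifferentiableAt ℝ (W i) (F z)) :
    DifferentiableAt ℝ (fun y => fderiv ℝ F y (EuclideanSpace.single 1 (1 : ℝ)) 1 * W 0 (F y) -
        fderiv ℝ F y (EuclideanSpace.single 1 (1 : ℝ)) 0 * W 1 (F y)) z ∧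
    DifferentiableAt ℝ (fun y => fderiv ℝ F y (EuclideanSpace.single 0 (1 : ℝ)) 0 * W 1 (F y) -
        fderiv ℝ F y (EuclideanSpace.single 0 (1 : ℝ)) 1 * W 0 (F y)) z ∧
    fderiv ℝ (fun y => fderiv ℝ F y (EuclideanSpace.single 1 (1 : ℝ)) 1 * W 0 (F y) -
        fderiv ℝ F y (EuclideanSpace.single 1 (1 : ℝ)) 0 * W 1 (F y)) z
        (EuclideanSpace.single 0 (1 : ℝ)) +
      fderiv ℝ (fun y => fderiv ℝ F y (EuclideanSpace.single 0 (1 : ℝ)) 0 * W 1 (F y) -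
        fderiv ℝ F y (EuclideanSpace.single 0 (1 : ℝ)) 1 * W 0 (F y)) z
        (EuclideanSpace.single 1 (1 : ℝ)) =
    (fderiv ℝ F z).det * ∑ i, fderiv ℝ (W i) (F z) (EuclideanSpace.single i (1 : ℝ)) := by
  -- Symmetry of D²F is the content of the identity: the terms in which the adjugate is
  -- differentiated are mixed second derivatives that cancel in pairs.
  have hsymm : IsSymmSndFDerivAt ℝ F z := 
    hF.isSymmSndFDerivAt (by rw [minSmoothness_of_isRCLikeNormedField]; exact ENat.LEInfty.out)
  have hG : HasFDerivAt (fderiv ℝ F) (fderiv ℝ (fderiv ℝ F) z) z :=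
    ((hF.fderiv_right (m := ∞) (by simp)).differentiableAt (by simp)).hasFDerivAt
  have hD : ∀ i j : Fin 2, HasFDerivAt (fun y => fderiv ℝ F y (EuclideanSpace.single j (1 : ℝ)) i)
      ((EuclideanSpace.proj i : Plane →L[ℝ] ℝ).comp
        ((ContinuousLinearMap.apply ℝ Plane (EuclideanSpace.single j (1 : ℝ))).comp
          (fderiv ℝ (fderiv ℝ F) z))) z := fun i j =>
    ((EuclideanSpace.proj i : Plane →L[ℝ] ℝ).hasFDerivAt).comp z
      ((ContinuousLinearMap.apply ℝ Plane (EuclideanSpace.single j (1 : ℝ))).hasFDerivAt.comp z hG)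
  have hWF : ∀ i, HasFDerivAt (fun y => W i (F y)) ((fderiv ℝ (W i) (F z)).comp (fderiv ℝ F z)) z :=
    fun i => (hW i).hasFDerivAt.comp z (hF.differentiableAt (by simp)).hasFDerivAt
  have h0 := ((hD 1 1).mul (hWF 0)).sub ((hD 0 1).mul (hWF 1))
  have h1 := ((hD 0 0).mul (hWF 1)).sub ((hD 1 0).mul (hWF 0))
  refine ⟨h0.differentiableAt, h1.differentiableAt, ?_⟩
  rw [show fderiv ℝ (fun y => fderiv ℝ F y (EuclideanSpace.single 1 (1 : ℝ)) 1 * W 0 (F y) -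
      fderiv ℝ F y (EuclideanSpace.single 1 (1 : ℝ)) 0 * W 1 (F y)) z = _ from h0.fderiv,
    show fderiv ℝ (fun y => fderiv ℝ F y (EuclideanSpace.single 0 (1 : ℝ)) 0 * W 1 (F y) -
      fderiv ℝ F y (EuclideanSpace.single 0 (1 : ℝ)) 1 * W 0 (F y)) z = _ from h1.fderiv, det_plane,
    Fin.sum_univ_two]
  have hs := hsymm (EuclideanSpace.single 0 (1 : ℝ)) (EuclideanSpace.single 1 (1 : ℝ))
  simp only [_root_.sub_apply, _root_.add_apply,
    _root_.smul_apply, ContinuousLinearMap.comp_apply, smul_eq_mul,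
    ContinuousLinearMap.apply_apply, PiLp.proj_apply, hs,
    sum_apply_eq (fderiv ℝ (W _) (F z)) (fderiv ℝ F z _)]
  ring

variable {e : OpenPartialHomeomorph M Plane}

theorem component_apply {y : Plane} (Y : Π x : M, TangentSpace (𝓡 2) x) (i : Fin 2) :
    component e Y i y = fwdDeriv e (e.symm y) (Y (e.symm y)) i :=
  rfl

/-- The components of a vector field in two charts are related by the differential of the
transition map. -/
theorem component_eq {e e' : OpenPartialHomeomorph M Plane}
    (he : e ∈ IsManifold.maximalAtlas (𝓡 2) ∞ M) (he' : e' ∈ IsManifold.maximalAtlas (𝓡 2) ∞ M)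
    (Y : Π x : M, TangentSpace (𝓡 2) x)
    {z : Plane} (hz : z ∈ e'.target) (hz' : e'.symm z ∈ e.source) (i : Fin 2) :
    component e Y i (e (e'.symm z)) =
      component e' Y 0 z * fderiv ℝ (e ∘ e'.symm) z (EuclideanSpace.single 0 (1 : ℝ)) i +
      component e' Y 1 z * fderiv ℝ (e ∘ e'.symm) z (EuclideanSpace.single 1 (1 : ℝ)) i := by
  have h1 : MDifferentiableAt (𝓡 2) (𝓡 2) e'.symm z :=
    (contMDiffAt_symm_of_mem_maximalAtlas he' hz).mdifferentiableAt (by simp)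
  have h2 : MDifferentiableAt (𝓡 2) (𝓡 2) e (e'.symm z) :=
    (contMDiffAt_of_mem_maximalAtlas he hz').mdifferentiableAt (by simp)
  have h3 : fderiv ℝ (e ∘ e'.symm) z = (fwdDeriv e (e'.symm z)).comp (bwdDeriv e' (e'.symm z)) := by
    rw [← mfderiv_eq_fderiv, mfderiv_comp z h2 h1, bwdDeriv, e'.right_inv hz]
    rfl
  have h4 := sum_apply_eq (fderiv ℝ (e ∘ e'.symm) z) (fwdDeriv e' (e'.symm z) (Y (e'.symm z)))
  have h5 : fderiv ℝ (e ∘ e'.symm) z (fwdDeriv e' (e'.symm z) (Y (e'.symm z))) =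
      fwdDeriv e (e'.symm z) (Y (e'.symm z)) := by
    rw [h3, ContinuousLinearMap.comp_apply]
    exact congrArg (fwdDeriv e _) (bwdDeriv_fwdDeriv he' (e'.map_target hz) _)
  rw [component_apply, e.left_inv hz', ← h5, h4]
  simp [component_apply]

/-- The vector field `a ∂ᵢ` of the chart `e`, extended by zero. -/
def localField (e : OpenPartialHomeomorph M Plane) (a : Plane → ℝ) (i : Fin 2) (x : M) :
    TangentSpace (𝓡 2) x :=
  haveI := Classical.propDecidable (x ∈ e.source)
  if x ∈ e.source then a (e x) • frame e i x else 0

theorem localField_of_mem {a : Plane → ℝ} {i : Fin 2} {x : M} (hx : x ∈ e.source) :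
    localField e a i x = a (e x) • frame e i x :=
  if_pos hx

theorem component_localField (he : e ∈ IsManifold.maximalAtlas (𝓡 2) ∞ M) {a : Plane → ℝ}
    {i j : Fin 2} {y : Plane} (hy : y ∈ e.target) :
    component e (localField e a i) j y = if j = i then a y else 0 := by
  have hx := e.map_target hy
  rw [component_apply, localField_of_mem hx]
  have h1 : fwdDeriv e (e.symm y) (a (e (e.symm y)) • frame e i (e.symm y)) =
      a y • EuclideanSpace.single i (1 : ℝ) := by
    rw [e.right_inv hy]
    exact (map_smul (fwdDeriv e (e.symm y)) _ _).trans
      (congrArg (a y • ·) (fwdDeriv_bwdDeriv he hx _))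
  refine (congrArg (fun v : Plane => v j) h1).trans ?_
  simp [PiLp.single_apply]

theorem localField_of_notMem {a : Plane → ℝ} {i : Fin 2} {x : M}
    (hx : x ∉ e.symm '' tsupport a) : localField e a i x = 0 := by
  by_cases hxe : x ∈ e.source
  · rw [localField_of_mem hxe, image_eq_zero_of_notMem_tsupport (f := a)
      fun h => hx ⟨e x, h, e.left_inv hxe⟩, zero_smul]
  · exact if_neg hxe

theorem isCompact_symm_image {N : Type*} [TopologicalSpace N]
    {e : OpenPartialHomeomorph N Plane} {K : Set Plane} (hK : IsCompact K) (hKe : K ⊆ e.target) :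
    IsCompact (e.symm '' K) :=
  hK.image_of_continuousOn (e.continuousOn_symm.mono hKe)

theorem isTestField_localField [IsManifold (𝓡 2) ∞ M] [T2Space M]
    (he : e ∈ IsManifold.maximalAtlas (𝓡 2) ∞ M)
    {a : Plane → ℝ} (hac : HasCompactSupport a) (hae : tsupport a ⊆ e.target)
    (ha : ContDiff ℝ ∞ a) {Ω : Set M} (hΩ : tsupport a ⊆ e.symm ⁻¹' Ω) (i : Fin 2) :
    IsTestField Ω (localField e a i) := by
  have hK := isCompact_symm_image hac hae
  refine ⟨fun x => ?_, _, hK, Set.image_subset_iff.2 hΩ, fun x hx => localField_of_notMem hx⟩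
  by_cases hx : x ∈ e.source
  · have h := (ha.contDiffAt.contMDiffAt.comp x (contMDiffAt_of_mem_maximalAtlas he hx)).smul_section
      (contMDiffAt_frame he hx i)
    refine h.congr_of_eventuallyEq ?_
    filter_upwards [e.open_source.mem_nhds hx] with z hz
    exact congrArg (TotalSpace.mk z) (localField_of_mem hz)
  -- Outside the chart the field is locally the zero section, because its support lies in a compact
  -- subset of the domain, which is closed as M is Hausdorff.
  · have hx' : x ∈ (e.symm '' tsupport a)ᶜ := fun ⟨y, hy, hyx⟩ =>
      hx (hyx ▸ e.map_target (hae hy))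
    refine (Bundle.contMDiff_zeroSection ℝ (TangentSpace (𝓡 2) (M := M)) x).congr_of_eventuallyEq ?_
    filter_upwards [hK.isClosed.isOpen_compl.mem_nhds hx'] with z hz
    exact congrArg (TotalSpace.mk z) (localField_of_notMem hz)

/-! ### The divergence in an arbitrary chart, and its product rule. -/

section Metric

variable [RiemannianBundle (fun x : M => TangentSpace (𝓡 2) x)]

/-- The divergence of a vector field, computed in the chart `e`, as a function of the
coordinates. -/
def chartDivergence (e : OpenPartialHomeomorph M Plane) (Y : Π x : M, TangentSpace (𝓡 2) x)
    (y : Plane) : ℝ :=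
  (density e y)⁻¹ * ∑ i : Fin 2,
    fderiv ℝ (fun y => density e y * component e Y i y) y (EuclideanSpace.single i (1 : ℝ))

theorem inner_grad_eq_sum (he : e ∈ IsManifold.maximalAtlas (𝓡 2) ∞ M) {x : M}
    (hx : x ∈ e.source) {u : M → ℝ} (hu : MDifferentiableAt (𝓡 2) 𝓘(ℝ, ℝ) u x)
    (Y : Π x : M, TangentSpace (𝓡 2) x) :
    (inner ℝ (grad u x) (Y x) : ℝ) = ∑ i : Fin 2, component e Y i (e x) *
      fderiv ℝ (u ∘ e.symm) (e x) (EuclideanSpace.single i (1 : ℝ)) := by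
  rw [eq_sum_component he hx Y, inner_add_right, real_inner_smul_right, real_inner_smul_right,
    inner_grad_frame he hx hu, inner_grad_frame he hx hu, Fin.sum_univ_two]

theorem divergence_of_eventually_zero {Y : Π x : M, TangentSpace (𝓡 2) x} {x : M}
    (h : ∀ᶠ z in nhds x, Y z = 0) : divergence Y x = 0 := by
  set e := chartAt Plane x with he_def
  have hx : x ∈ e.source := mem_chart_source Plane x
  have hc : Filter.Tendsto e.symm (nhds (e x)) (nhds x) := e.tendsto_symm hx
  have h2 : ∀ i, (fun y => density e y * component e Y i y) =ᶠ[nhds (e x)] fun _ => 0 := by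
    intro i
    filter_upwards [hc.eventually h] with y hy
    rw [component_apply, hy]
    have h3 : fwdDeriv e (e.symm y) 0 = 0 := map_zero _
    have h4 : fwdDeriv e (e.symm y) 0 i = 0 := by rw [h3]; rfl
    exact mul_eq_zero_of_right _ h4
  rw [divergence, ← he_def]
  simp [(h2 _).fderiv_eq]

variable [IsManifold (𝓡 2) ∞ M]
  [IsContMDiffRiemannianBundle (𝓡 2) ∞ Plane (fun x : M => TangentSpace (𝓡 2) x)]

/-- `divergence` uses the preferred chart of each point, which jumps from point to point, so even
its continuity requires independence of the chart. For the transition map F, the field √g′ Y′ in one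
chart is ± the Piola transform of √g Y in the other, and `piola` turns its divergence into ± det(DF)
times the other divergence. The factor |det DF| also relates the two densities, so it cancels. -/
theorem divergence_eq_chartDivergence (he : e ∈ IsManifold.maximalAtlas (𝓡 2) ∞ M)
    {Y : Π x : M, TangentSpace (𝓡 2) x} {x : M} (hx : x ∈ e.source)
    (hY : ∀ i, DifferentiableAt ℝ (component e Y i) (e x)) :
    divergence Y x = chartDivergence e Y (e x) := by
  set e' := chartAt Plane x with he'_def
  have he' : e' ∈ IsManifold.maximalAtlas (𝓡 2) ∞ M := IsManifold.chart_mem_maximalAtlas x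
  have hx' : x ∈ e'.source := mem_chart_source Plane x
  set z₀ := e' x
  have hz₀ : z₀ ∈ e'.target := e'.map_source hx'
  have hsz₀ : e'.symm z₀ = x := e'.left_inv hx'
  set F := e ∘ e'.symm with hF_def
  have hFz₀ : F z₀ = e x := by simp [hF_def, hsz₀]
  have hF : ContDiffAt ℝ ∞ F z₀ := by
    have h2 := contMDiffAt_of_mem_maximalAtlas he hx
    rw [← hsz₀] at h2
    exact (h2.comp z₀ (contMDiffAt_symm_of_mem_maximalAtlas he' hz₀)).contDiffAt
  have hev : ∀ᶠ z in nhds z₀, z ∈ e'.target ∧ e'.symm z ∈ e.source :=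
    (e'.open_target.eventually_mem hz₀).and ((e'.continuousAt_symm hz₀).preimage_mem_nhds
      (e.open_source.mem_nhds (by rwa [hsz₀])))
  have hdens : ∀ {z}, z ∈ e'.target → e'.symm z ∈ e.source →
      density e' z = |(fderiv ℝ F z).det| * density e (F z) :=
    fun hz hz' => (density_eq he' he hz hz').2
  -- Densities are positive in both charts and differ by the factor |det DF|, which therefore cannot
  -- vanish.
  have hdet₀ : (fderiv ℝ F z₀).det ≠ 0 := by
    intro h
    have h1 := hdens hz₀ (by rwa [hsz₀])
    rw [h, abs_zero, zero_mul] at h1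
    exact (density_pos he' hz₀).ne' h1
  have hcont : ContinuousAt (fun z => (fderiv ℝ F z).det) z₀ := by
    have h1 : ContinuousAt (fderiv ℝ F) z₀ :=
      (hF.fderiv_right (m := ∞) (by simp)).continuousAt
    simp only [det_plane]
    have h2 : ∀ i j : Fin 2, ContinuousAt
        (fun y => fderiv ℝ F y (EuclideanSpace.single j (1 : ℝ)) i) z₀ := fun i j =>
      (EuclideanSpace.proj i : Plane →L[ℝ] ℝ).continuous.continuousAt.comp
        (h1.clm_apply continuousAt_const)
    exact ((h2 0 0).mul (h2 1 1)).sub ((h2 0 1).mul (h2 1 0))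
  -- The number s is the sign of det DF, locally constant by continuity; it replaces the absolute
  -- value by something that can be differentiated.
  obtain ⟨s, hs⟩ : ∃ s : ℝ, ∀ᶠ z in nhds z₀, |(fderiv ℝ F z).det| = s * (fderiv ℝ F z).det := by
    rcases hdet₀.lt_or_gt with h | h
    · refine ⟨-1, ?_⟩
      filter_upwards [hcont.eventually_lt_const h] with z hz
      rw [abs_of_neg hz, neg_one_mul]
    · refine ⟨1, ?_⟩
      filter_upwards [hcont.eventually_const_lt h] with z hz
      rw [abs_of_pos hz, one_mul]
  set W : Fin 2 → Plane → ℝ := fun i y => density e y * component e Y i y with hW_def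
  have hW : ∀ i, DifferentiableAt ℝ (W i) (F z₀) := by
    intro i
    rw [hFz₀]
    exact ((contDiffAt_density he (e.map_source hx)).differentiableAt (by simp)).mul (hY i)
  obtain ⟨hd0, hd1, hp⟩ := piola hF hW
  have key0 : (fun z => density e' z * component e' Y 0 z) =ᶠ[nhds z₀] fun y =>
      s * (fderiv ℝ F y (EuclideanSpace.single 1 (1 : ℝ)) 1 * W 0 (F y) -
        fderiv ℝ F y (EuclideanSpace.single 1 (1 : ℝ)) 0 * W 1 (F y)) := by
    filter_upwards [hev, hs] with z hz hsz
    simp only [hW_def]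
    rw [hdens hz.1 hz.2, hsz]
    simp only [hF_def, Function.comp_apply, component_eq he he' Y hz.1 hz.2, det_plane]
    ring
  have key1 : (fun z => density e' z * component e' Y 1 z) =ᶠ[nhds z₀] fun y =>
      s * (fderiv ℝ F y (EuclideanSpace.single 0 (1 : ℝ)) 0 * W 1 (F y) -
        fderiv ℝ F y (EuclideanSpace.single 0 (1 : ℝ)) 1 * W 0 (F y)) := by
    filter_upwards [hev, hs] with z hz hsz
    simp only [hW_def]
    rw [hdens hz.1 hz.2, hsz]
    simp only [hF_def, Function.comp_apply, component_eq he he' Y hz.1 hz.2, det_plane]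
    ring
  have hlhs : divergence Y x = (density e' z₀)⁻¹ *
      ((fderiv ℝ (fun z => density e' z * component e' Y 0 z) z₀) (EuclideanSpace.single 0 (1 : ℝ)) +
      (fderiv ℝ (fun z => density e' z * component e' Y 1 z) z₀) (EuclideanSpace.single 1 (1 : ℝ))) := by
    rw [← Fin.sum_univ_two (f := fun i => (fderiv ℝ (fun z => density e' z * component e' Y i z) z₀)
      (EuclideanSpace.single i (1 : ℝ)))]
    rfl
  rw [hlhs, key0.fderiv_eq, key1.fderiv_eq, fderiv_const_mul hd0, fderiv_const_mul hd1]
  simp only [_root_.smul_apply, smul_eq_mul]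
  rw [← mul_add, hp, hdens hz₀ (by rwa [hsz₀]), chartDivergence, ← hFz₀, ← mul_assoc s,
    ← hs.self_of_nhds, mul_inv, mul_comm (|_|⁻¹), mul_assoc,
    inv_mul_cancel_left₀ (abs_ne_zero.2 hdet₀)]

theorem contDiffAt_density_mul_component (he : e ∈ IsManifold.maximalAtlas (𝓡 2) ∞ M)
    {Y : Π x : M, TangentSpace (𝓡 2) x} {y : Plane} (hy : y ∈ e.target)
    (hY : ContMDiff (𝓡 2) (𝓡 2).tangent ∞ (fun x => (⟨x, Y x⟩ : TangentBundle (𝓡 2) M)))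
    (i : Fin 2) : ContDiffAt ℝ ∞ (fun y => density e y * component e Y i y) y :=
  (contDiffAt_density he hy).mul (contDiffAt_component he hy (hY _) i)

theorem continuous_divergence {Y : Π x : M, TangentSpace (𝓡 2) x}
    (hY : ContMDiff (𝓡 2) (𝓡 2).tangent ∞ (fun x => (⟨x, Y x⟩ : TangentBundle (𝓡 2) M))) :
    Continuous (divergence Y) := by
  refine continuous_iff_continuousAt.2 fun x => ?_
  set e := chartAt Plane x
  have he : e ∈ IsManifold.maximalAtlas (𝓡 2) ∞ M := IsManifold.chart_mem_maximalAtlas x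
  have hx : x ∈ e.source := mem_chart_source Plane x
  have h1 : ContinuousAt (chartDivergence e Y) (e x) := by
    have hy := e.map_source hx
    refine ((contDiffAt_density he hy).continuousAt.inv₀ (density_pos he hy).ne').mul ?_
    refine tendsto_finsetSum _ fun i _ => ?_
    exact ((contDiffAt_density_mul_component he hy hY i).fderiv_right
      (m := ∞) (by simp)).continuousAt.clm_apply continuousAt_const
  refine (h1.comp (e.continuousAt hx)).congr ?_
  filter_upwards [e.open_source.mem_nhds hx] with z hz
  exact (divergence_eq_chartDivergence he hz fun i =>
    (contDiffAt_component he (e.map_source hz) (hY _) i).differentiableAt (by simp)).symm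

theorem divergence_smul {u : M → ℝ} (hu : ContMDiff (𝓡 2) 𝓘(ℝ, ℝ) ∞ u)
    {Y : Π x : M, TangentSpace (𝓡 2) x}
    (hY : ContMDiff (𝓡 2) (𝓡 2).tangent ∞ (fun x => (⟨x, Y x⟩ : TangentBundle (𝓡 2) M)))
    (x : M) :
    divergence (fun x => u x • Y x) x = u x * divergence Y x + inner ℝ (grad u x) (Y x) := by
  set e := chartAt Plane x with he_def
  have he : e ∈ IsManifold.maximalAtlas (𝓡 2) ∞ M := IsManifold.chart_mem_maximalAtlas x
  have hx : x ∈ e.source := mem_chart_source Plane x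
  have hy := e.map_source hx
  have h1 : ∀ i, fderiv ℝ (fun y => density e y * component e (fun x => u x • Y x) i y) (e x)
      (EuclideanSpace.single i (1 : ℝ)) =
      u x * fderiv ℝ (fun y => density e y * component e Y i y) (e x)
        (EuclideanSpace.single i (1 : ℝ)) +
      density e (e x) * (component e Y i (e x) *
        fderiv ℝ (u ∘ e.symm) (e x) (EuclideanSpace.single i (1 : ℝ))) := by
    intro i
    have h2 : (fun y => density e y * component e (fun x => u x • Y x) i y) =
        fun y => (u ∘ e.symm) y * (density e y * component e Y i y) := by
      funext y
      have h3 := congrArg (fun v : Plane => v i)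
        (map_smul (fwdDeriv e (e.symm y)) (u (e.symm y)) (Y (e.symm y)))
      have h4 : component e (fun x => u x • Y x) i y = u (e.symm y) * component e Y i y := h3
      rw [h4, Function.comp_apply]
      ring
    rw [h2, fderiv_fun_mul
      ((contDiffAt_of_contMDiffAt he hy hu.contMDiffAt).differentiableAt (by simp))
      ((contDiffAt_density_mul_component he hy hY i).differentiableAt (by simp))]
    simp only [_root_.smul_apply, _root_.add_apply, smul_eq_mul, Function.comp_apply,
      e.left_inv hx]
    ring
  rw [inner_grad_eq_sum he hx (hu.mdifferentiableAt (by simp)), divergence, divergence, ← he_def]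
  simp only [h1, Fin.sum_univ_two]
  field_simp [(density_pos he hy).ne']
  ring

/-- The coefficient φ/√g is chosen so that √g cancels inside the derivative. The remaining factor
1/√g is absorbed by the volume, so integrals against this divergence become Lebesgue integrals
against ∂ᵢφ. -/
theorem divergence_localField (he : e ∈ IsManifold.maximalAtlas (𝓡 2) ∞ M)
    {φ : Plane → ℝ} {i : Fin 2} {x : M} (hx : x ∈ e.source) (hφ : ContDiff ℝ ∞ φ) :
    divergence (localField e (fun y => (density e y)⁻¹ * φ y) i) x =
      (density e (e x))⁻¹ * fderiv ℝ φ (e x) (EuclideanSpace.single i (1 : ℝ)) := by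
  have hy := e.map_source hx
  have hev : ∀ᶠ z in nhds (e x), z ∈ e.target := e.open_target.eventually_mem hy
  rw [divergence_eq_chartDivergence he hx, chartDivergence]
  · congr 1
    rw [Finset.sum_eq_single i]
    · have h1 : (fun y => density e y * component e (localField e (fun y => (density e y)⁻¹ * φ y) i)
          i y) =ᶠ[nhds (e x)] φ := by
        filter_upwards [hev] with z hz
        rw [component_localField he hz, if_pos rfl, mul_inv_cancel_left₀ (density_pos he hz).ne']
      rw [h1.fderiv_eq]
    · intro j _ hji
      have h1 : (fun y => density e y * component e (localField e (fun y => (density e y)⁻¹ * φ y) i)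
          j y) =ᶠ[nhds (e x)] fun _ => 0 := by
        filter_upwards [hev] with z hz
        rw [component_localField he hz, if_neg hji, mul_zero]
      rw [h1.fderiv_eq]
      simp
    · simp
  · intro j
    have h1 : component e (localField e (fun y => (density e y)⁻¹ * φ y) i) j
        =ᶠ[nhds (e x)] fun y => if j = i then (density e y)⁻¹ * φ y else 0 := by
      filter_upwards [hev] with z hz using component_localField he hz
    refine DifferentiableAt.congr_of_eventuallyEq ?_ h1
    split_ifs
    · exact (((contDiffAt_density he hy).inv (density_pos he hy).ne').mul
        hφ.contDiffAt).differentiableAt (by simp)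
    · exact differentiableAt_const _

end Metric

end WeightedCKN

namespace WeightedCKN

/-! ### Mollification in the plane -/

theorem eLpNorm_two_sq {α F : Type*} [MeasurableSpace α] [NormedAddCommGroup F] (μ : Measure α)
    (f : α → F) : eLpNorm f 2 μ ^ 2 = ∫⁻ x, ‖f x‖ₑ ^ 2 ∂μ := by
  have h := eLpNorm_nnreal_pow_eq_lintegral (f := f) (μ := μ) (p := 2) (by simp)
  have h2 : ((2 : NNReal) : ℝ) = (2 : ℕ) := by norm_num
  have h3 : ((2 : NNReal) : ℝ≥0∞) = 2 := by norm_num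
  rw [h2, h3] at h
  simpa only [ENNReal.rpow_natCast] using h

/-- Translations are measure preserving and depend continuously on t in the compact-open topology,
so composition with them acts continuously on L². -/
theorem exists_translate_close {f : Plane → ℝ} (hf : MemLp f 2) {ε : ℝ≥0∞} (hε : ε ≠ 0) :
    ∃ δ > 0, ∀ t : Plane, ‖t‖ < δ → eLpNorm (fun y => f (y - t) - f y) 2 ≤ ε := by
  let g : Plane → C(Plane, Plane) := fun t => ⟨fun y => y - t, by fun_prop⟩
  have hg : Continuous g :=
    ContinuousMap.continuous_of_continuous_uncurry _ (continuous_snd.sub continuous_fst)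
  have hgm : ∀ t, MeasurePreserving (g t) volume volume :=
    fun t => measurePreserving_sub_right volume t
  have hc := (continuous_const (y := hf.toLp f)).compMeasurePreservingLp hg hgm ENNReal.ofNat_ne_top
  have h0 := (EMetric.tendsto_nhds.1 (hc.tendsto 0)) ε hε.bot_lt
  obtain ⟨δ, hδ, h⟩ := Metric.eventually_nhds_iff.1 h0
  refine ⟨δ, hδ, fun t ht => ?_⟩
  have h1 := (h (by simpa using ht)).le
  rw [Lp.edist_def] at h1
  refine (eLpNorm_congr_ae ?_).trans_le h1
  have hcoe : ∀ s, ((Lp.compMeasurePreserving (g s) (hgm s)) (hf.toLp f) : Plane → ℝ)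
      =ᵐ[volume] fun y => f (y - s) := fun s =>
    (Lp.coeFn_compMeasurePreserving _ (hgm s)).trans
      ((hgm s).quasiMeasurePreserving.ae_eq_comp hf.coeFn_toLp)
  filter_upwards [hcoe t, hcoe 0] with y h1 h2
  rw [Pi.sub_apply, h1, h2, sub_zero]

/-- Averages of translates of a function are as close to it in `L²` as the translates are. -/
theorem eLpNorm_convolution_sub_le {f η : Plane → ℝ} (hf : MemLp f 2) (hη : Continuous η)
    (hηc : HasCompactSupport η) (hη0 : ∀ t, 0 ≤ η t) (hη1 : ∫ t, η t = 1) {ε : ℝ≥0∞}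
    (h : ∀ t, η t ≠ 0 → eLpNorm (fun y => f (y - t) - f y) 2 ≤ ε) :
    eLpNorm (fun y => convolution η f (ContinuousLinearMap.lsmul ℝ ℝ) volume y - f y) 2 ≤ ε := by
  have hηi : Integrable η := hη.integrable_of_hasCompactSupport hηc
  have hm1 : ∫⁻ t, ENNReal.ofReal (η t) = 1 := by
    rw [← ofReal_integral_eq_lintegral_ofReal hηi (Filter.Eventually.of_forall hη0), hη1,
      ENNReal.ofReal_one]
  -- Under the probability measure ν = η dt the error of the convolution is the mean of f(y − t) −
  -- f(y). Its square is at most the mean square, and Tonelli then exchanges y and t.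
  set ν := (volume : Measure Plane).withDensity fun t => ENNReal.ofReal (η t) with hν
  have hηm : Measurable fun t => ENNReal.ofReal (η t) := hη.measurable.ennreal_ofReal
  have : IsProbabilityMeasure ν := ⟨by rw [hν, withDensity_apply _ MeasurableSet.univ]; simpa using hm1⟩
  have hνac : ν ≪ volume := withDensity_absolutelyContinuous _ _
  have hmeas2 : AEStronglyMeasurable (fun p : Plane × Plane => f (p.1 - p.2) - f p.1)
      (volume.prod volume) :=
    (hf.1.comp_quasiMeasurePreserving (quasiMeasurePreserving_sub volume volume)).sub
      hf.1.comp_fst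
  have hpt : ∀ y, ‖convolution η f (ContinuousLinearMap.lsmul ℝ ℝ) volume y - f y‖ₑ ^ 2 ≤
      ∫⁻ t, ENNReal.ofReal (η t) * ‖f (y - t) - f y‖ₑ ^ 2 := by
    intro y
    have hfy : AEStronglyMeasurable (fun t => f (y - t) - f y) volume :=
      (hf.1.comp_quasiMeasurePreserving (quasiMeasurePreserving_sub_left volume y)).sub
        aestronglyMeasurable_const
    have hint : Integrable fun t => η t • f (y - t) :=
      (hηc.convolutionExists_left (ContinuousLinearMap.lsmul ℝ ℝ) hη
        (hf.locallyIntegrable (by simp))) y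
    have h1 : convolution η f (ContinuousLinearMap.lsmul ℝ ℝ) volume y - f y =
        ∫ t, η t • (f (y - t) - f y) := by
      simp_rw [smul_sub]
      rw [convolution_lsmul, integral_sub hint (hηi.smul_const (f y)), integral_smul_const, hη1,
        one_smul]
    have h2 : ‖convolution η f (ContinuousLinearMap.lsmul ℝ ℝ) volume y - f y‖ₑ ≤
        eLpNorm (fun t => f (y - t) - f y) 1 ν := by
      rw [h1, eLpNorm_one_eq_lintegral_enorm, hν,
        lintegral_withDensity_eq_lintegral_mul₀ hηm.aemeasurable hfy.enorm]
      refine (enorm_integral_le_lintegral_enorm _).trans (lintegral_mono fun t => ?_)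
      rw [enorm_smul, Pi.mul_apply, Real.enorm_of_nonneg (hη0 t)]
    have h3 := h2.trans (eLpNorm_le_eLpNorm_of_exponent_le (p := 1) (q := 2) (by norm_num)
      (hfy.mono_ac hνac))
    refine (pow_le_pow_left' h3 2).trans_eq ?_
    rw [eLpNorm_two_sq, hν, lintegral_withDensity_eq_lintegral_mul₀ hηm.aemeasurable
      (hfy.enorm.pow_const 2)]
    rfl
  refine (ENNReal.pow_le_pow_left_iff two_ne_zero).1 ?_
  rw [eLpNorm_two_sq]
  calc ∫⁻ y, ‖convolution η f (ContinuousLinearMap.lsmul ℝ ℝ) volume y - f y‖ₑ ^ 2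
      ≤ ∫⁻ y, ∫⁻ t, ENNReal.ofReal (η t) * ‖f (y - t) - f y‖ₑ ^ 2 := lintegral_mono hpt
    _ = ∫⁻ t, ∫⁻ y, ENNReal.ofReal (η t) * ‖f (y - t) - f y‖ₑ ^ 2 :=
        lintegral_lintegral_swap
          ((hηm.comp measurable_snd).aemeasurable.mul (hmeas2.enorm.pow_const 2))
    _ ≤ ∫⁻ t, ENNReal.ofReal (η t) * ε ^ 2 := by
        refine lintegral_mono fun t => ?_
        rw [lintegral_const_mul' _ _ ENNReal.ofReal_ne_top, ← eLpNorm_two_sq]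
        by_cases ht : η t = 0
        · simp [ht]
        · gcongr
          exact h t ht
    _ = ε ^ 2 := by rw [lintegral_mul_const _ hηm, hm1, one_mul]

/-- The derivative of a mollification is the mollification of the weak derivative. -/
theorem fderiv_convolution_of_weak {v g η : Plane → ℝ} {w : Plane} (hv : LocallyIntegrable v)
    (hη : ContDiff ℝ ∞ η) (hηc : HasCompactSupport η)
    (hweak : ∀ φ : Plane → ℝ, ContDiff ℝ ∞ φ → HasCompactSupport φ →
      ∫ y, v y * fderiv ℝ φ y w = - ∫ y, g y * φ y) (y : Plane) :
    fderiv ℝ (convolution η v (ContinuousLinearMap.lsmul ℝ ℝ) volume) y w =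
      convolution η g (ContinuousLinearMap.lsmul ℝ ℝ) volume y := by
  set L : ℝ →L[ℝ] ℝ →L[ℝ] ℝ := ContinuousLinearMap.lsmul ℝ ℝ
  have hη1 : ContDiff ℝ 1 η := hη.of_le (by simp)
  have h1 := hηc.hasFDerivAt_convolution_left L hη1 hv y
  have hint : Integrable fun t => (L.precompL Plane (fderiv ℝ η t)) (v (y - t)) :=
    (hηc.fderiv ℝ).convolutionExists_left (L.precompL Plane) (hη1.continuous_fderiv (by simp)) hv y
  rw [h1.fderiv, convolution_def, ContinuousLinearMap.integral_apply hint]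
  have h2 : ∀ t, (L.precompL Plane (fderiv ℝ η t)) (v (y - t)) w =
      (fun z => v z * fderiv ℝ η (y - z) w) (y - t) := by
    intro t
    simp [ContinuousLinearMap.precompL_apply, L, mul_comm]
  simp_rw [h2]
  rw [integral_sub_left_eq_self (fun z => v z * fderiv ℝ η (y - z) w) volume y]
  have h3 : ∀ z, fderiv ℝ η (y - z) w = - fderiv ℝ (fun z => η (y - z)) z w := by
    intro z
    have h4 : HasFDerivAt (fun z => η (y - z)) ((fderiv ℝ η (y - z)).comp (-ContinuousLinearMap.id ℝ Plane)) z :=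
      ((hη1.differentiable (by simp)) (y - z)).hasFDerivAt.comp z ((hasFDerivAt_id z).const_sub y)
    rw [h4.fderiv]
    simp
  simp_rw [h3, mul_neg, integral_neg]
  -- The weak derivative is tested with z ↦ η(y − z); the sign from differentiating in z cancels the
  -- sign of the integration by parts.
  rw [hweak (fun z => η (y - z)) (hη.comp (contDiff_const.sub contDiff_id))
    (hηc.comp_homeomorph (Homeomorph.subLeft y)), neg_neg, convolution_lsmul,
    ← integral_sub_left_eq_self (fun t => g t * η (y - t)) volume y]
  simp [mul_comm]

/-- Functions with compact support in an open set `U` and with weak derivatives in `L²` are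
approximated by smooth functions with supports in a fixed compact subset of `U`. -/
theorem exists_contDiff_approx {K U : Set Plane} (hK : IsCompact K) (hU : IsOpen U) (hKU : K ⊆ U)
    {v : Plane → ℝ} {g : Fin 2 → Plane → ℝ} (hv : MemLp v 2) (hg : ∀ i, MemLp (g i) 2)
    (hvK : ∀ y ∉ K, v y = 0)
    (hweak : ∀ i, ∀ φ : Plane → ℝ, ContDiff ℝ ∞ φ → HasCompactSupport φ →
      ∫ y, v y * fderiv ℝ φ y (EuclideanSpace.single i (1 : ℝ)) = - ∫ y, g i y * φ y) :
    ∃ K' : Set Plane, IsCompact K' ∧ K ⊆ K' ∧ K' ⊆ U ∧ ∀ ε : ℝ≥0∞, ε ≠ 0 →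
      ∃ φ : Plane → ℝ, ContDiff ℝ ∞ φ ∧ tsupport φ ⊆ K' ∧
        eLpNorm (fun y => φ y - v y) 2 ≤ ε ∧
        ∀ i, eLpNorm (fun y => fderiv ℝ φ y (EuclideanSpace.single i (1 : ℝ)) - g i y) 2 ≤ ε := by
  obtain ⟨δ, hδ, hδU⟩ := hK.exists_cthickening_subset_open hU hKU
  refine ⟨Metric.cthickening δ K, hK.cthickening, Metric.self_subset_cthickening K, hδU,
    fun ε hε => ?_⟩
  obtain ⟨δ₀, hδ₀, h₀⟩ := exists_translate_close hv hε
  choose δ₁ hδ₁ h₁ using fun i => exists_translate_close (hg i) hε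
  -- The radius of the mollifier meets all requirements at once: δ keeps the support in the
  -- thickening of K, while δ₀ and δ₁ control the translates of v and of its weak derivatives.
  obtain ⟨r, hr, hrδ, hr₀, hr₁⟩ : ∃ r > 0, r ≤ δ ∧ r ≤ δ₀ ∧ ∀ i, r ≤ δ₁ i := by
    refine ⟨min (min δ δ₀) (min (δ₁ 0) (δ₁ 1)), by simp [hδ, hδ₀, hδ₁], ?_, ?_, ?_⟩
    · exact (min_le_left _ _).trans (min_le_left _ _)
    · exact (min_le_left _ _).trans (min_le_right _ _)
    · intro i
      fin_cases i
      · exact (min_le_right _ _).trans (min_le_left _ _)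
      · exact (min_le_right _ _).trans (min_le_right _ _)
  let b : ContDiffBump (0 : Plane) := ⟨r / 2, r, by positivity, by linarith⟩
  set η := b.normed volume
  have hη : ContDiff ℝ ∞ η := b.contDiff_normed
  have hηc : HasCompactSupport η := b.hasCompactSupport_normed
  have hηt : ∀ t, η t ≠ 0 → ‖t‖ < r := by
    intro t ht
    have h : t ∈ Function.support η := ht
    rw [b.support_normed_eq] at h
    simpa using h
  have hvl : LocallyIntegrable v := hv.locallyIntegrable (by simp)
  refine ⟨convolution η v (ContinuousLinearMap.lsmul ℝ ℝ) volume,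
    hηc.contDiff_convolution_left _ hη hvl, ?_, ?_, fun i => ?_⟩
  · refine closure_minimal ((support_convolution_subset _).trans ?_) Metric.isClosed_cthickening
    rintro _ ⟨t, ht, z, hz, rfl⟩
    have hzK : z ∈ K := by
      by_contra h
      exact hz (hvK z h)
    refine Metric.mem_cthickening_of_dist_le _ z δ K hzK ?_
    simpa using (hηt t ht).le.trans hrδ
  · exact eLpNorm_convolution_sub_le hv hη.continuous hηc b.nonneg_normed b.integral_normed
      fun t ht => h₀ t ((hηt t ht).trans_le hr₀)
  · simp_rw [fderiv_convolution_of_weak hvl hη hηc (hweak i)]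
    exact eLpNorm_convolution_sub_le (hg i) hη.continuous hηc b.nonneg_normed b.integral_normed
      fun t ht => h₁ i t ((hηt t ht).trans_le (hr₁ i))

end WeightedCKN

namespace WeightedCKN

variable {M : Type*} [TopologicalSpace M] [ChartedSpace Plane M]

/-! ### The Riemannian volume in a chart -/

variable [RiemannianBundle (fun x : M => TangentSpace (𝓡 2) x)]

/-- The measure `√(det gᵢⱼ) dy` on the target of the chart `e`. -/
def coordMeasure (e : OpenPartialHomeomorph M Plane) : Measure Plane :=
  (volume.restrict e.target).withDensity fun y => ENNReal.ofReal (density e y)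

variable {e : OpenPartialHomeomorph M Plane}

theorem coordMeasure_restrict {K : Set Plane} (hK : MeasurableSet K) (hKe : K ⊆ e.target) :
    (coordMeasure e).restrict K =
      (volume.restrict K).withDensity fun y => ENNReal.ofReal (density e y) := by
  rw [coordMeasure, restrict_withDensity hK, Measure.restrict_restrict hK,
    Set.inter_eq_left.2 hKe]

theorem chartMeasure_eq_map [MeasurableSpace M] :  chartMeasure e = (coordMeasure e).map e.symm :=
  rfl

theorem aemeasurable_symm [MeasurableSpace M] [BorelSpace M] : AEMeasurable e.symm (coordMeasure e) :=
  (e.continuousOn_symm.aemeasurable e.open_target.measurableSet).mono_ac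
    (withDensity_absolutelyContinuous _ _)

theorem ae_coordMeasure_mem_target : ∀ᵐ y ∂(coordMeasure e), y ∈ e.target :=
  (withDensity_absolutelyContinuous _ _).ae_le (ae_restrict_mem e.open_target.measurableSet)

variable [IsManifold (𝓡 2) ∞ M]
  [IsContMDiffRiemannianBundle (𝓡 2) ∞ Plane (fun x : M => TangentSpace (𝓡 2) x)]

theorem continuousOn_density (he : e ∈ IsManifold.maximalAtlas (𝓡 2) ∞ M) :
    ContinuousOn (density e) e.target :=
  fun _ hy => (contDiffAt_density he hy).continuousAt.continuousWithinAt

/-- The density is continuous and positive, hence bounded above and away from zero on compact sets.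
This bound and `exists_volume_le` let L² estimates pass between Lebesgue measure and the Riemannian
volume in both directions. -/
theorem exists_coordMeasure_le (he : e ∈ IsManifold.maximalAtlas (𝓡 2) ∞ M) {K : Set Plane}
    (hK : IsCompact K) (hKe : K ⊆ e.target) :
    ∃ C : ℝ≥0∞, C ≠ ⊤ ∧ (coordMeasure e).restrict K ≤ C • volume.restrict K := by
  obtain ⟨C, hC⟩ := hK.exists_bound_of_continuousOn ((continuousOn_density he).mono hKe)
  refine ⟨ENNReal.ofReal C, ENNReal.ofReal_ne_top, ?_⟩
  rw [coordMeasure_restrict hK.measurableSet hKe, ← withDensity_const]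
  refine withDensity_mono ((ae_restrict_iff' hK.measurableSet).2 (.of_forall fun y hy => ?_))
  exact ENNReal.ofReal_le_ofReal ((Real.le_norm_self _).trans (hC y hy))

theorem exists_volume_le (he : e ∈ IsManifold.maximalAtlas (𝓡 2) ∞ M) {K : Set Plane}
    (hK : IsCompact K) (hKe : K ⊆ e.target) :
    ∃ C : ℝ≥0∞, C ≠ ⊤ ∧ volume.restrict K ≤ C • (coordMeasure e).restrict K := by
  obtain ⟨C, hC⟩ := hK.exists_bound_of_continuousOn (f := fun y => (density e y)⁻¹)
    (((continuousOn_density he).mono hKe).inv₀ fun y hy => (density_pos he (hKe hy)).ne')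
  refine ⟨ENNReal.ofReal C, ENNReal.ofReal_ne_top, ?_⟩
  rw [coordMeasure_restrict hK.measurableSet hKe,
    ← withDensity_smul' _ _ ENNReal.ofReal_ne_top]
  nth_rewrite 1 [← withDensity_one (μ := volume.restrict K)]
  refine withDensity_mono ((ae_restrict_iff' hK.measurableSet).2 (.of_forall fun y hy => ?_))
  have h0 := density_pos he (hKe hy)
  have h1 : (density e y)⁻¹ ≤ C := (Real.le_norm_self _).trans (hC y hy)
  rw [Pi.one_apply, Pi.smul_apply, smul_eq_mul,
    ← ENNReal.ofReal_mul ((inv_nonneg.2 h0.le).trans h1), ENNReal.one_le_ofReal]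
  calc (1 : ℝ) = (density e y)⁻¹ * density e y := (inv_mul_cancel₀ h0.ne').symm
    _ ≤ C * density e y := by gcongr

variable [MeasurableSpace M] [BorelSpace M]

/-- `L²` norms on the manifold are bounded by those in the coordinates. -/
theorem exists_eLpNorm_vol_le (p : M) {K : Set Plane}
    (hK : IsCompact K) (hKe : K ⊆ (chartAt Plane p).target) :
    ∃ C : ℝ≥0∞, C ≠ ⊤ ∧ ∀ q : M → ℝ, (∀ x ∉ (chartAt Plane p).symm '' K, q x = 0) →
      eLpNorm q 2 (vol M) ≤
        C * eLpNorm (fun y => q ((chartAt Plane p).symm y)) 2 (volume.restrict K) := by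
  set e := chartAt Plane p with he_def
  have he : e ∈ IsManifold.maximalAtlas (𝓡 2) ∞ M := IsManifold.chart_mem_maximalAtlas p
  obtain ⟨C, hC, hle⟩ := exists_coordMeasure_le he hK hKe
  -- After squaring, a constant with square at least C is needed; C + 1 serves without a square
  -- root.
  refine ⟨C + 1, by simp [hC], fun q hq => ?_⟩
  refine (ENNReal.pow_le_pow_left_iff two_ne_zero).1 ?_
  have hsupp : Function.support (fun x => ‖q x‖ₑ ^ 2) ⊆ e.source := by
    intro x hx
    by_contra hxe
    refine hx ?_
    have h0 : q x = 0 := hq x ?_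
    · simp [h0]
    · rintro ⟨y, hy, rfl⟩
      exact hxe (e.map_target (hKe hy))
  rw [mul_pow, eLpNorm_two_sq, eLpNorm_two_sq]
  calc ∫⁻ x, ‖q x‖ₑ ^ 2 ∂(vol M) = ∫⁻ x in e.source, ‖q x‖ₑ ^ 2 ∂(vol M) :=
        (setLIntegral_eq_of_support_subset hsupp).symm
    _ = ∫⁻ x, ‖q x‖ₑ ^ 2 ∂((coordMeasure e).map e.symm) := by
        rw [vol_restrict_source p]
        rfl
    -- An inequality suffices here, and it needs no measurability of q.
    _ ≤ ∫⁻ y, ‖q (e.symm y)‖ₑ ^ 2 ∂(coordMeasure e) := lintegral_map_le _ _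
    _ = ∫⁻ y in K, ‖q (e.symm y)‖ₑ ^ 2 ∂(coordMeasure e) := by
        rw [← lintegral_indicator hK.measurableSet]
        refine lintegral_congr_ae ?_
        filter_upwards [ae_coordMeasure_mem_target] with y hy
        by_cases hyK : y ∈ K
        · rw [Set.indicator_of_mem hyK]
        · rw [Set.indicator_of_notMem hyK, hq]
          · simp
          · rintro ⟨z, hz, hzy⟩
            exact hyK (e.symm.injOn (hKe hz) hy hzy ▸ hz)
    _ ≤ ∫⁻ y, ‖q (e.symm y)‖ₑ ^ 2 ∂(C • volume.restrict K) := lintegral_mono' hle le_rfl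
    _ = C * ∫⁻ y in K, ‖q (e.symm y)‖ₑ ^ 2 := by rw [lintegral_smul_measure, smul_eq_mul]
    _ ≤ (C + 1) ^ 2 * ∫⁻ y in K, ‖q (e.symm y)‖ₑ ^ 2 := by
        gcongr
        calc C ≤ C + 1 := le_self_add
          _ ≤ (C + 1) ^ 2 := le_self_pow (by simp) two_ne_zero

/-- Square integrable functions on the manifold are square integrable in the coordinates. -/
theorem memLp_comp_symm (p : M) {K : Set Plane}
    (hK : IsCompact K) (hKe : K ⊆ (chartAt Plane p).target) {q : M → ℝ}
    (hq : MemLp q 2 ((vol M).restrict ((chartAt Plane p).symm '' K))) [T2Space M] :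
    MemLp (fun y => q ((chartAt Plane p).symm y)) 2 (volume.restrict K) := by
  set e := chartAt Plane p with he_def
  have he : e ∈ IsManifold.maximalAtlas (𝓡 2) ∞ M := IsManifold.chart_mem_maximalAtlas p
  obtain ⟨C, hC, hle⟩ := exists_volume_le he hK hKe
  have hKM : MeasurableSet (e.symm '' K) := (isCompact_symm_image hK hKe).measurableSet
  have hsub : e.symm '' K ⊆ e.source := by
    rintro _ ⟨y, hy, rfl⟩
    exact e.map_target (hKe hy)
  have h1 : (vol M).restrict (e.symm '' K) =
      ((coordMeasure e).restrict (e.symm ⁻¹' (e.symm '' K))).map e.symm := by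
    rw [← Measure.restrict_map_of_aemeasurable aemeasurable_symm hKM, ← chartMeasure_eq_map,
      ← vol_restrict_source p, Measure.restrict_restrict hKM, Set.inter_eq_left.2 hsub]
  rw [h1, memLp_map_measure_iff] at hq
  · refine MemLp.of_measure_le_smul hC hle (hq.mono_measure ?_)
    exact Measure.restrict_mono (Set.subset_preimage_image _ _) le_rfl
  · exact hq.1
  · exact aemeasurable_symm.mono_measure Measure.restrict_le_self

/-- Integrals over the domain of a chart, in coordinates. -/
theorem integral_vol_eq (p : M) {q : M → ℝ} (hq : AEStronglyMeasurable q (vol M))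
    (h0 : ∀ x ∉ (chartAt Plane p).source, q x = 0) :
    ∫ x, q x ∂(vol M) = ∫ y in (chartAt Plane p).target,
      density (chartAt Plane p) y * q ((chartAt Plane p).symm y) := by
  set e := chartAt Plane p with he_def
  have he : e ∈ IsManifold.maximalAtlas (𝓡 2) ∞ M := IsManifold.chart_mem_maximalAtlas p
  have hq' := hq.restrict (s := e.source)
  rw [← setIntegral_eq_integral_of_forall_compl_eq_zero h0, vol_restrict_source p,
    chartMeasure_eq_map, integral_map aemeasurable_symm, coordMeasure,
    integral_withDensity_eq_integral_toReal_smul₀]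
  · refine setIntegral_congr_fun e.open_target.measurableSet fun y hy => ?_
    exact congrArg (· * q (e.symm y)) (ENNReal.toReal_ofReal (density_pos he hy).le)
  · exact ((continuousOn_density he).aemeasurable e.open_target.measurableSet).ennreal_ofReal
  · exact .of_forall fun _ => ENNReal.ofReal_lt_top
  · rwa [vol_restrict_source p] at hq'

/-- Local finiteness makes continuous functions with compact support square integrable; a compact
coordinate neighbourhood has finite Lebesgue measure and bounded density. -/
instance isLocallyFiniteMeasure_vol : IsLocallyFiniteMeasure (vol M) := by
  refine ⟨fun p => ?_⟩
  set e := chartAt Plane p with he_def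
  have he : e ∈ IsManifold.maximalAtlas (𝓡 2) ∞ M := IsManifold.chart_mem_maximalAtlas p
  have hp : p ∈ e.source := mem_chart_source Plane p
  obtain ⟨K, hKn, hKe, hK⟩ := local_compact_nhds (e.open_target.mem_nhds (e.map_source hp))
  obtain ⟨C, hC, hle⟩ := exists_coordMeasure_le he hK hKe
  set U := e.source ∩ e ⁻¹' interior K
  have hU : IsOpen U := e.isOpen_inter_preimage isOpen_interior
  refine ⟨U, hU.mem_nhds ⟨hp, mem_interior_iff_mem_nhds.2 hKn⟩, ?_⟩
  have h1 : vol M U = chartMeasure e U := by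
    rw [← vol_restrict_source p, Measure.restrict_apply hU.measurableSet,
      Set.inter_eq_left.2 Set.inter_subset_left]
  rw [h1, chartMeasure_eq_map, Measure.map_apply_of_aemeasurable aemeasurable_symm hU.measurableSet]
  calc coordMeasure e (e.symm ⁻¹' U) ≤ coordMeasure e K := by
        refine measure_mono_ae ?_
        filter_upwards [ae_coordMeasure_mem_target] with y hy hyU
        have := hyU.2
        rw [Set.mem_preimage, e.right_inv hy] at this
        exact interior_subset this
    _ = (coordMeasure e).restrict K K := by rw [Measure.restrict_apply_self]
    _ ≤ (C • volume.restrict K) K := hle K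
    _ < ⊤ := by
        rw [Measure.smul_apply, Measure.restrict_apply_self, smul_eq_mul]
        exact ENNReal.mul_lt_top hC.lt_top hK.measure_lt_top

end WeightedCKN

namespace WeightedCKN

variable {M : Type*} [TopologicalSpace M] [ChartedSpace Plane M]

/-! ### Test functions and test fields -/

theorem aestronglyMeasurable_of_restrict {α : Type*} [MeasurableSpace α] {μ : Measure α}
    {s : Set α} (hs : MeasurableSet s) {q : α → ℝ} (hq : AEStronglyMeasurable q (μ.restrict s))
    (h0 : ∀ x ∉ s, q x = 0) : AEStronglyMeasurable q μ := by
  rw [← aestronglyMeasurable_indicator_iff hs] at hq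
  rwa [Set.indicator_eq_self.2 fun x hx => by_contra fun h => hx (h0 x h)] at hq

section TestFunctions

variable {Ω : Set M} {u v : M → ℝ}

theorem IsTestFunction.eq_zero (hu : IsTestFunction Ω u) {x : M} (hx : x ∉ Ω) : u x = 0 :=
  image_eq_zero_of_notMem_tsupport fun h => hx (hu.support_subset h)

theorem IsTestFunction.add (hu : IsTestFunction Ω u) (hv : IsTestFunction Ω v) :
    IsTestFunction Ω (fun x => u x + v x) :=
  ⟨hu.smooth.add hv.smooth, hu.compact.add hv.compact,
    (tsupport_add u v).trans (Set.union_subset hu.support_subset hv.support_subset)⟩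

theorem IsTestFunction.mul_left (hu : IsTestFunction Ω u) (hv : ContMDiff (𝓡 2) 𝓘(ℝ, ℝ) ∞ v) :
    IsTestFunction Ω (fun x => v x * u x) :=
  ⟨hv.mul hu.smooth, hu.compact.mul_left,
    (tsupport_mul_subset_right (f := v) (g := u)).trans hu.support_subset⟩

theorem isTestFunction_zero : IsTestFunction Ω (fun _ : M => (0 : ℝ)) :=
  ⟨contMDiff_const, HasCompactSupport.zero, by
    have : tsupport (fun _ : M => (0 : ℝ)) = ∅ := tsupport_eq_empty_iff.2 rfl
    rw [this]
    exact Set.empty_subset _⟩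

theorem IsTestField.eq_zero [IsManifold (𝓡 2) ∞ M] {Y : Π x : M, TangentSpace (𝓡 2) x}
    (hY : IsTestField Ω Y) {x : M} (hx : x ∉ Ω) : Y x = 0 := by
  obtain ⟨K, -, hK, h0⟩ := hY.compact
  exact h0 x fun h => hx (hK h)

theorem IsTestField.smul [IsManifold (𝓡 2) ∞ M] {Y : Π x : M, TangentSpace (𝓡 2) x}
    (hY : IsTestField Ω Y) (hu : ContMDiff (𝓡 2) 𝓘(ℝ, ℝ) ∞ u) :
    IsTestField Ω (fun x => u x • Y x) := by
  obtain ⟨K, hK, hKΩ, h0⟩ := hY.compact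
  exact ⟨hu.smul_section hY.smooth, K, hK, hKΩ, fun x hx => by rw [h0 x hx, smul_zero]⟩

end TestFunctions

section Metric

variable [RiemannianBundle (fun x : M => TangentSpace (𝓡 2) x)] {Ω : Set M}

theorem grad_congr {u v : M → ℝ} {x : M} (h : u =ᶠ[nhds x] v) : grad u x = grad v x := by
  refine ext_inner_right ℝ fun w => ?_
  rw [inner_grad, inner_grad, h.mfderiv_eq]
  rfl

theorem grad_const (c : ℝ) (x : M) : grad (fun _ : M => c) x = 0 := by
  refine ext_inner_right ℝ fun w => ?_
  rw [inner_grad, mfderiv_const, inner_zero_left]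
  rfl

theorem grad_of_notMem_tsupport {u : M → ℝ} {x : M} (hx : x ∉ tsupport u) : grad u x = 0 :=
  (grad_congr (notMem_tsupport_iff_eventuallyEq.1 hx)).trans (grad_const 0 x)

theorem grad_add {u v : M → ℝ} {x : M} (hu : MDifferentiableAt (𝓡 2) 𝓘(ℝ, ℝ) u x)
    (hv : MDifferentiableAt (𝓡 2) 𝓘(ℝ, ℝ) v x) :
    grad (fun x => u x + v x) x = grad u x + grad v x := by
  refine ext_inner_right ℝ fun w => ?_
  rw [inner_add_left, inner_grad, inner_grad, inner_grad]
  exact DFunLike.congr_fun (hu.hasMFDerivAt.add hv.hasMFDerivAt).mfderiv w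

theorem grad_mul {u v : M → ℝ} {x : M} (hu : MDifferentiableAt (𝓡 2) 𝓘(ℝ, ℝ) u x)
    (hv : MDifferentiableAt (𝓡 2) 𝓘(ℝ, ℝ) v x) :
    grad (fun x => u x * v x) x = u x • grad v x + v x • grad u x := by
  refine ext_inner_right ℝ fun w => ?_
  rw [inner_add_left, real_inner_smul_left, real_inner_smul_left, inner_grad, inner_grad,
    inner_grad]
  exact DFunLike.congr_fun (hu.hasMFDerivAt.mul hv.hasMFDerivAt).mfderiv w

theorem divergence_eq_zero [T2Space M] {Y : Π x : M, TangentSpace (𝓡 2) x} {K : Set M}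
    (hK : IsCompact K) (h0 : ∀ x ∉ K, Y x = 0) {x : M} (hx : x ∉ K) : divergence Y x = 0 := by
  refine divergence_of_eventually_zero ?_
  filter_upwards [hK.isClosed.isOpen_compl.mem_nhds hx] with z hz using h0 z hz

variable [IsManifold (𝓡 2) ∞ M]

theorem IsTestField.divergence_eq_zero [T2Space M] {Y : Π x : M, TangentSpace (𝓡 2) x}
    (hY : IsTestField Ω Y) {x : M} (hx : x ∉ Ω) : divergence Y x = 0 := by
  obtain ⟨K, hK, hKΩ, h0⟩ := hY.compact
  exact WeightedCKN.divergence_eq_zero hK h0 fun h => hx (hKΩ h)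

variable [IsContMDiffRiemannianBundle (𝓡 2) ∞ Plane (fun x : M => TangentSpace (𝓡 2) x)]

theorem IsTestFunction.isTestField_grad {u : M → ℝ} (hu : IsTestFunction Ω u) :
    IsTestField Ω (grad u) :=
  ⟨contMDiff_grad hu.smooth, tsupport u, hu.compact, hu.support_subset,
    fun _ hx => grad_of_notMem_tsupport hx⟩

theorem continuous_inner_field {X Y : Π x : M, TangentSpace (𝓡 2) x}
    (hX : ContMDiff (𝓡 2) (𝓡 2).tangent ∞ (fun x => (⟨x, X x⟩ : TangentBundle (𝓡 2) M)))
    (hY : ContMDiff (𝓡 2) (𝓡 2).tangent ∞ (fun x => (⟨x, Y x⟩ : TangentBundle (𝓡 2) M))) :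
    Continuous fun x => (inner ℝ (X x) (Y x) : ℝ) :=
  continuous_iff_continuousAt.2 fun x => (contMDiffAt_inner (hX x) (hY x)).continuousAt

theorem continuous_norm_field {X : Π x : M, TangentSpace (𝓡 2) x}
    (hX : ContMDiff (𝓡 2) (𝓡 2).tangent ∞ (fun x => (⟨x, X x⟩ : TangentBundle (𝓡 2) M))) :
    Continuous fun x => ‖X x‖ := by
  simp_rw [norm_eq_sqrt_real_inner]
  exact (continuous_inner_field hX hX).sqrt

end Metric

/-! ### Transfer of test functions between a chart and the manifold -/

section Charts

variable {e : OpenPartialHomeomorph M Plane} {Ω : Set M}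

/-- Extension by zero is smooth because the function vanishes off a compact set inside the chart,
whose complement is open. The same reason serves in the other direction in
`isTestFunction_chart_pullback`. -/
theorem contDiff_chart_extension [T2Space M] (he : e ∈ IsManifold.maximalAtlas (𝓡 2) ∞ M)
    {ψ : M → ℝ} (hψ : ContMDiff (𝓡 2) 𝓘(ℝ, ℝ) ∞ ψ) (hψc : HasCompactSupport ψ)
    (hψe : tsupport ψ ⊆ e.source) :
    IsCompact (e '' tsupport ψ) ∧ e '' tsupport ψ ⊆ e.target ∧
    ContDiff ℝ ∞ (e.target.indicator (ψ ∘ e.symm)) ∧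
    ∀ y ∉ e '' tsupport ψ, e.target.indicator (ψ ∘ e.symm) y = 0 := by
  have hK : IsCompact (e '' tsupport ψ) := hψc.isCompact.image_of_continuousOn
    (e.continuousOn.mono hψe)
  have hKe : e '' tsupport ψ ⊆ e.target := by
    rintro _ ⟨x, hx, rfl⟩
    exact e.map_source (hψe hx)
  have h0 : ∀ y ∉ e '' tsupport ψ, e.target.indicator (ψ ∘ e.symm) y = 0 := by
    intro y hy
    by_cases hye : y ∈ e.target
    · rw [Set.indicator_of_mem hye]
      exact image_eq_zero_of_notMem_tsupport (f := ψ) fun h => hy ⟨_, h, e.right_inv hye⟩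
    · exact Set.indicator_of_notMem hye _
  refine ⟨hK, hKe, contDiff_iff_contDiffAt.2 fun y => ?_, h0⟩
  by_cases hy : y ∈ e.target
  · refine (contDiffAt_of_contMDiffAt he hy hψ.contMDiffAt).congr_of_eventuallyEq ?_
    filter_upwards [e.open_target.mem_nhds hy] with z hz using Set.indicator_of_mem hz _
  · refine (contDiffAt_const (c := (0 : ℝ))).congr_of_eventuallyEq ?_
    filter_upwards [hK.isClosed.isOpen_compl.mem_nhds fun h => hy (hKe h)] with z hz using h0 z hz

theorem isTestFunction_chart_pullback [T2Space M] (he : e ∈ IsManifold.maximalAtlas (𝓡 2) ∞ M)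
    {φ : Plane → ℝ} (hφ : ContDiff ℝ ∞ φ) {K : Set Plane} (hK : IsCompact K)
    (hφK : tsupport φ ⊆ K) (hKe : K ⊆ e.target ∩ e.symm ⁻¹' Ω) :
    IsTestFunction Ω (e.source.indicator (φ ∘ e)) ∧
    ∀ x ∉ e.symm '' K, e.source.indicator (φ ∘ e) x = 0 := by
  have hKM := isCompact_symm_image hK (hKe.trans Set.inter_subset_left)
  have h0 : ∀ x ∉ e.symm '' K, e.source.indicator (φ ∘ e) x = 0 := by
    intro x hx
    by_cases hxe : x ∈ e.source
    · rw [Set.indicator_of_mem hxe]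
      exact image_eq_zero_of_notMem_tsupport (f := φ) fun h => hx ⟨_, hφK h, e.left_inv hxe⟩
    · exact Set.indicator_of_notMem hxe _
  refine ⟨⟨fun x => ?_, ?_, ?_⟩, h0⟩
  · by_cases hx : x ∈ e.source
    · refine (hφ.contDiffAt.contMDiffAt.comp x
        (contMDiffAt_of_mem_maximalAtlas he hx)).congr_of_eventuallyEq ?_
      filter_upwards [e.open_source.mem_nhds hx] with z hz using Set.indicator_of_mem hz _
    · refine (contMDiffAt_const (c := (0 : ℝ))).congr_of_eventuallyEq ?_
      have hx' : x ∉ e.symm '' K := by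
        rintro ⟨y, hy, rfl⟩
        exact hx (e.map_target (hKe hy).1)
      filter_upwards [hKM.isClosed.isOpen_compl.mem_nhds hx'] with z hz using h0 z hz
  · exact HasCompactSupport.intro hKM h0
  · refine (closure_minimal (fun x hx => ?_) hKM.isClosed).trans
      (Set.image_subset_iff.2 fun y hy => (hKe hy).2)
    by_contra h
    exact hx (h0 x h)

end Charts

/-! ### Weak gradients in a chart -/

section WeakGradient

variable [RiemannianBundle (fun x : M => TangentSpace (𝓡 2) x)] [MeasurableSpace M]
  [IsManifold (𝓡 2) ∞ M]
  {Ω : Set M} {w : M → ℝ} {X : Π x : M, TangentSpace (𝓡 2) x}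

theorem HasWeakGradient.memLp_restrict (hw : HasWeakGradient Ω w X) {K : Set M}
    (hK : IsCompact K) (hKΩ : K ⊆ Ω) : MemLp w 2 ((vol M).restrict K) :=
  (memLp_two_iff_integrable_sq (hw.aestronglyMeasurable.mono_measure
    (Measure.restrict_mono hKΩ le_rfl))).2 (hw.sq_integrable.integrableOn_compact_subset hKΩ hK)

theorem HasWeakGradient.aestronglyMeasurable_norm [SecondCountableTopology M]
    (hw : HasWeakGradient Ω w X) :
    AEStronglyMeasurable (fun x => ‖X x‖) ((vol M).restrict Ω) := by
  have h := Real.continuous_sqrt.comp_aestronglyMeasurable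
    hw.sq_integrable_gradient.aestronglyMeasurable
  simpa only [Real.sqrt_sq (norm_nonneg _)] using h

theorem HasWeakGradient.memLp_norm_restrict [SecondCountableTopology M]
    (hw : HasWeakGradient Ω w X) {K : Set M}
    (hK : IsCompact K) (hKΩ : K ⊆ Ω) : MemLp (fun x => ‖X x‖) 2 ((vol M).restrict K) :=
  (memLp_two_iff_integrable_sq (hw.aestronglyMeasurable_norm.mono_measure
    (Measure.restrict_mono hKΩ le_rfl))).2
    (hw.sq_integrable_gradient.integrableOn_compact_subset hKΩ hK)

theorem HasWeakGradient.integral_eq' [T2Space M] (hw : HasWeakGradient Ω w X)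
    {Y : Π x : M, TangentSpace (𝓡 2) x} (hY : IsTestField Ω Y) :
    ∫ x, w x * divergence Y x ∂(vol M) = - ∫ x, (inner ℝ (X x) (Y x) : ℝ) ∂(vol M) := by
  rw [← setIntegral_eq_integral_of_forall_compl_eq_zero (s := Ω), hw.integral_eq Y hY,
    setIntegral_eq_integral_of_forall_compl_eq_zero]
  · intro x hx
    rw [hY.eq_zero hx, inner_zero_right]
  · intro x hx
    rw [hY.divergence_eq_zero hx, mul_zero]

variable [BorelSpace M]
  [IsContMDiffRiemannianBundle (𝓡 2) ∞ Plane (fun x : M => TangentSpace (𝓡 2) x)]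

/-- The weak gradient in a chart is given by the weak partial derivatives. -/
theorem HasWeakGradient.integral_chart_eq [T2Space M]
    (hΩ : IsOpen Ω) (hw : HasWeakGradient Ω w X) (p : M) {Φ : Plane → ℝ} (hΦ : ContDiff ℝ ∞ Φ)
    (hΦc : HasCompactSupport Φ) (hΦe : tsupport Φ ⊆ (chartAt Plane p).target)
    (hΦΩ : tsupport Φ ⊆ (chartAt Plane p).symm ⁻¹' Ω) (i : Fin 2) :
    ∫ y in (chartAt Plane p).target, w ((chartAt Plane p).symm y) *
        fderiv ℝ Φ y (EuclideanSpace.single i (1 : ℝ)) =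
      - ∫ y in (chartAt Plane p).target, (inner ℝ (X ((chartAt Plane p).symm y))
        (frame (chartAt Plane p) i ((chartAt Plane p).symm y)) : ℝ) * Φ y := by
  set e := chartAt Plane p with he_def
  have he : e ∈ IsManifold.maximalAtlas (𝓡 2) ∞ M := IsManifold.chart_mem_maximalAtlas p
  -- The field Y = (Φ/√g) ∂ᵢ has divergence ∂ᵢΦ/√g, so the density of the volume cancels on both
  -- sides of the weak identity.
  set a : Plane → ℝ := fun y => (density e y)⁻¹ * Φ y with ha_def
  have hats : tsupport a ⊆ tsupport Φ := tsupport_mul_subset_right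
  have ha : ContDiff ℝ ∞ a := by
    refine contDiff_iff_contDiffAt.2 fun y => ?_
    by_cases hy : y ∈ tsupport Φ
    · exact ((contDiffAt_density he (hΦe hy)).inv (density_pos he (hΦe hy)).ne').mul hΦ.contDiffAt
    · refine (contDiffAt_const (c := (0 : ℝ))).congr_of_eventuallyEq ?_
      filter_upwards [notMem_tsupport_iff_eventuallyEq.1 hy] with z hz
      rw [ha_def]
      simp only [hz, Pi.zero_apply, mul_zero]
  have hac : HasCompactSupport a := hΦc.mul_left
  set Y := localField e a i with hY_def
  have hY : IsTestField Ω Y := isTestField_localField he hac (hats.trans hΦe) ha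
    (hats.trans hΦΩ) i
  have hK := isCompact_symm_image (e := e) hac (hats.trans hΦe)
  have hsrc : ∀ x ∉ e.source, x ∉ e.symm '' tsupport a := by
    rintro _ hx ⟨y, hy, rfl⟩
    exact hx (e.map_target (hΦe (hats hy)))
  have h := hw.integral_eq' hY
  rw [integral_vol_eq p, integral_vol_eq p] at h
  · refine Eq.trans ?_ (h.trans (congrArg Neg.neg ?_))
    · refine setIntegral_congr_fun e.open_target.measurableSet fun y hy => ?_
      have hd := divergence_localField he (i := i) (e.map_target hy) hΦ
      rw [e.right_inv hy] at hd
      rw [← he_def, hY_def, ha_def, hd]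
      field_simp [(density_pos he hy).ne']
    · refine setIntegral_congr_fun e.open_target.measurableSet fun y hy => ?_
      rw [← he_def, hY_def, localField_of_mem (e.map_target hy), real_inner_smul_right,
        e.right_inv hy, ha_def]
      field_simp [(density_pos he hy).ne']
  · refine aestronglyMeasurable_of_restrict hΩ.measurableSet
      (hw.integrable_inner Y hY).aestronglyMeasurable fun x hx => ?_
    rw [hY.eq_zero hx, inner_zero_right]
  · intro x hx
    rw [hY_def, localField_of_notMem (hsrc x hx), inner_zero_right]
  · refine aestronglyMeasurable_of_restrict hΩ.measurableSet (hw.aestronglyMeasurable.mul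
      (continuous_divergence hY.smooth).aestronglyMeasurable) fun x hx => ?_
    rw [hY.divergence_eq_zero hx, mul_zero]
  · intro x hx
    rw [divergence_eq_zero hK (fun z hz => localField_of_notMem hz) (hsrc x hx), mul_zero]

end WeakGradient

end WeightedCKN

namespace WeightedCKN

variable {M : Type*} [TopologicalSpace M] [ChartedSpace Plane M]

/-! ### Approximation by test functions -/

variable [RiemannianBundle (fun x : M => TangentSpace (𝓡 2) x)] [IsManifold (𝓡 2) ∞ M]
  [IsContMDiffRiemannianBundle (𝓡 2) ∞ Plane (fun x : M => TangentSpace (𝓡 2) x)]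
  {e : OpenPartialHomeomorph M Plane}

/-- The constant is the square root of a bound for tr G / det G on K, which is uniform in the field
W. For gradients the scalar products on the right are partial derivatives, so coordinate estimates
control the Riemannian norm. -/
theorem exists_norm_le_inner_frame (he : e ∈ IsManifold.maximalAtlas (𝓡 2) ∞ M) {K : Set Plane}
    (hK : IsCompact K) (hKe : K ⊆ e.target) :
    ∃ C : ℝ, 0 ≤ C ∧ ∀ (W : Π x : M, TangentSpace (𝓡 2) x), ∀ y ∈ K,
      ‖W (e.symm y)‖ ≤ C * (|inner ℝ (W (e.symm y)) (frame e 0 (e.symm y))| +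
        |inner ℝ (W (e.symm y)) (frame e 1 (e.symm y))|) := by
  have hdet : ∀ y ∈ e.target, 0 < (metricMatrix e y).det := by
    intro y hy
    have h := det_metricMatrix_pos he (e.map_target hy)
    rwa [e.right_inv hy] at h
  have hc : ContinuousOn (fun y => (metricMatrix e y).trace / (metricMatrix e y).det) K := by
    intro y hy
    have h : ∀ i j, ContinuousAt (fun y => metricMatrix e y i j) y := fun i j =>
      (contDiffAt_metricMatrix he (hKe hy) i j).continuousAt
    have hd := (hdet y (hKe hy)).ne'
    simp only [Matrix.trace_fin_two, Matrix.det_fin_two] at hd ⊢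
    exact (((h 0 0).add (h 1 1)).div (((h 0 0).mul (h 1 1)).sub ((h 0 1).mul (h 1 0)))
      hd).continuousWithinAt
  obtain ⟨B, hB⟩ := hK.exists_bound_of_continuousOn hc
  refine ⟨√B, Real.sqrt_nonneg _, fun W y hy => ?_⟩
  have hB0 : 0 ≤ B := (norm_nonneg _).trans (hB y hy)
  have h1 := det_mul_norm_sq_le he (e.map_target (hKe hy)) W
  rw [e.right_inv (hKe hy)] at h1
  have hd := hdet y (hKe hy)
  set s : ℝ := inner ℝ (W (e.symm y)) (frame e 0 (e.symm y))
  set t : ℝ := inner ℝ (W (e.symm y)) (frame e 1 (e.symm y))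
  have h2 : ‖W (e.symm y)‖ ^ 2 ≤ B * (s ^ 2 + t ^ 2) := by
    calc ‖W (e.symm y)‖ ^ 2 ≤
          (metricMatrix e y).trace / (metricMatrix e y).det * (s ^ 2 + t ^ 2) := by
          rw [div_mul_eq_mul_div, le_div_iff₀ hd, mul_comm]
          exact h1
      _ ≤ B * (s ^ 2 + t ^ 2) := by
          gcongr
          exact (Real.le_norm_self _).trans (hB y hy)
  refine (pow_le_pow_iff_left₀ (norm_nonneg _) (by positivity) two_ne_zero).1 (h2.trans ?_)
  rw [mul_pow, Real.sq_sqrt hB0]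
  gcongr
  rw [add_sq, sq_abs, sq_abs]
  have : 0 ≤ 2 * |s| * |t| := by positivity
  linarith

variable [MeasurableSpace M] [BorelSpace M]

/-- The function `ψ w` and its weak gradient `ψ X + w ∇ψ` are approximated in `L²` by test
functions and their gradients. -/
def IsApproximable (Ω : Set M) (w : M → ℝ) (X : Π x : M, TangentSpace (𝓡 2) x) (ψ : M → ℝ) :
    Prop :=
  ∀ ε : ℝ≥0∞, ε ≠ 0 → ∃ u : M → ℝ, IsTestFunction Ω u ∧
    eLpNorm (fun x => u x - ψ x * w x) 2 (vol M) ≤ ε ∧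
    eLpNorm (fun x => ‖grad u x - (ψ x • X x + w x • grad ψ x)‖) 2 (vol M) ≤ ε

variable [T2Space M] [SecondCountableTopology M]
  {Ω : Set M} {w : M → ℝ} {X : Π x : M, TangentSpace (𝓡 2) x} {ψ : M → ℝ}

/-- In a chart, the product of a function in `W^{1,2}` and of a test function is in `W^{1,2}`. -/
theorem HasWeakGradient.memLp_chart (hΩ : IsOpen Ω) (hw : HasWeakGradient Ω w X) (p : M)
    (hep : e = chartAt Plane p) {K : Set Plane} (hK : IsCompact K) (hKe : K ⊆ e.target)
    (hKΩ : K ⊆ e.symm ⁻¹' Ω) {θ : Plane → ℝ} (hθ : ContDiff ℝ ∞ θ) (hθ0 : ∀ y ∉ K, θ y = 0) :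
    MemLp (fun y => θ y * w (e.symm y)) 2 ∧
    (∀ i : Fin 2, MemLp (fun y => w (e.symm y) *
      fderiv ℝ θ y (EuclideanSpace.single i (1 : ℝ)) +
        θ y * inner ℝ (X (e.symm y)) (frame e i (e.symm y))) 2) ∧
    ∀ i : Fin 2, ∀ φ : Plane → ℝ, ContDiff ℝ ∞ φ → HasCompactSupport φ →
      ∫ y, θ y * w (e.symm y) * fderiv ℝ φ y (EuclideanSpace.single i (1 : ℝ)) =
        - ∫ y, (w (e.symm y) * fderiv ℝ θ y (EuclideanSpace.single i (1 : ℝ)) +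
          θ y * inner ℝ (X (e.symm y)) (frame e i (e.symm y))) * φ y := by
  have he : e ∈ IsManifold.maximalAtlas (𝓡 2) ∞ M := hep ▸ IsManifold.chart_mem_maximalAtlas p
  have hθK : tsupport θ ⊆ K := closure_minimal
    (fun y hy => by_contra fun h => hy (hθ0 y h)) hK.isClosed
  have hθc : HasCompactSupport θ := HasCompactSupport.intro hK hθ0
  have hKM : IsCompact (e.symm '' K) := isCompact_symm_image hK hKe
  have hKMΩ : e.symm '' K ⊆ Ω := Set.image_subset_iff.2 hKΩ
  have hdθ : ∀ i : Fin 2, Continuous fun y => fderiv ℝ θ y (EuclideanSpace.single i (1 : ℝ)) :=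
    fun i => (hθ.continuous_fderiv (by simp)).clm_apply continuous_const
  have hdθ0 : ∀ i, ∀ y ∉ K, fderiv ℝ θ y (EuclideanSpace.single i (1 : ℝ)) = 0 := by
    intro i y hy
    rw [fderiv_of_notMem_tsupport (𝕜 := ℝ) fun h => hy (hθK h)]
    rfl
  have hdθc : ∀ i : Fin 2, HasCompactSupport
      fun y => fderiv ℝ θ y (EuclideanSpace.single i (1 : ℝ)) :=
    fun i => HasCompactSupport.intro hK (hdθ0 i)
  have hwK : MemLp (K.indicator fun y => w (e.symm y)) 2 := by
    rw [memLp_indicator_iff_restrict hK.measurableSet]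
    subst hep
    exact memLp_comp_symm p hK hKe (hw.memLp_restrict hKM hKMΩ)
  have hA : MemLp (fun y => θ y * w (e.symm y)) 2 := by
    have h := hwK.mul' (hθ.continuous.memLp_top_of_hasCompactSupport hθc volume) (r := 2)
    refine (memLp_congr_ae (.of_forall fun y => ?_)).1 h
    by_cases hy : y ∈ K
    · simp [Set.indicator_of_mem hy]
    · simp [hθ0 y hy]
  have hB : ∀ i : Fin 2, MemLp
      (fun y => w (e.symm y) * fderiv ℝ θ y (EuclideanSpace.single i (1 : ℝ))) 2 := by
    intro i
    have h := hwK.mul' ((hdθ i).memLp_top_of_hasCompactSupport (hdθc i) volume) (r := 2)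
    refine (memLp_congr_ae (.of_forall fun y => ?_)).1 h
    by_cases hy : y ∈ K
    · simp [Set.indicator_of_mem hy, mul_comm]
    · simp [hdθ0 i y hy]
  have hD : ∀ i : Fin 2, MemLp
      (fun y => θ y * (inner ℝ (X (e.symm y)) (frame e i (e.symm y)) : ℝ)) 2 := by
    intro i
    -- The field θ∂ᵢ is a test field, so ⟨X, θ∂ᵢ⟩ is measurable by the definition of a weak
    -- gradient. Cauchy–Schwarz against |X| then gives square integrability.
    have hY : IsTestField Ω (localField e θ i) :=
      isTestField_localField he hθc (hθK.trans hKe) hθ (hθK.trans hKΩ) i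
    obtain ⟨C, hC⟩ := hKM.exists_bound_of_continuousOn
      (continuous_norm_field hY.smooth).continuousOn
    have h1 : MemLp (fun x => (inner ℝ (X x) (localField e θ i x) : ℝ)) 2
        ((vol M).restrict (e.symm '' K)) := by
      refine (hw.memLp_norm_restrict hKM hKMΩ).of_le_mul (c := C)
        ((hw.integrable_inner _ hY).aestronglyMeasurable.mono_measure
          (Measure.restrict_mono hKMΩ le_rfl)) ?_
      refine (ae_restrict_iff' hKM.measurableSet).2 (.of_forall fun x hx => ?_)
      have h2 := hC x hx
      rw [norm_norm] at h2 ⊢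
      refine (norm_inner_le_norm _ _).trans ?_
      rw [mul_comm]
      gcongr
    have h2 : MemLp (K.indicator fun y => (inner ℝ (X (e.symm y))
        (localField e θ i (e.symm y)) : ℝ)) 2 := by
      rw [memLp_indicator_iff_restrict hK.measurableSet]
      subst hep
      exact memLp_comp_symm p hK hKe h1
    refine (memLp_congr_ae (.of_forall fun y => ?_)).1 h2
    by_cases hy : y ∈ K
    · simp only [Set.indicator_of_mem hy]
      rw [localField_of_mem (e.map_target (hKe hy)), e.right_inv (hKe hy), real_inner_smul_right]
    · rw [hθ0 y hy, zero_mul, Set.indicator_of_notMem hy]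
  refine ⟨hA, fun i => (hB i).add (hD i), fun i φ hφ hφc => ?_⟩
  have hφ2 : MemLp φ 2 := hφ.continuous.memLp_of_hasCompactSupport hφc
  have hdφ2 : MemLp (fun y => fderiv ℝ φ y (EuclideanSpace.single i (1 : ℝ))) 2 :=
    ((hφ.continuous_fderiv (by simp)).clm_apply continuous_const).memLp_of_hasCompactSupport
      (hφc.fderiv_apply (𝕜 := ℝ) _)
  have hΦK : tsupport (fun y => θ y * φ y) ⊆ K := tsupport_mul_subset_left.trans hθK
  -- The weak identity is tested with θφ. The term φ∂ᵢθ of the product rule, moved to the other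
  -- side, gives the weak derivative of θw.
  have h : ∫ y in e.target, w (e.symm y) *
        fderiv ℝ (fun y => θ y * φ y) y (EuclideanSpace.single i (1 : ℝ)) =
      - ∫ y in e.target, (inner ℝ (X (e.symm y)) (frame e i (e.symm y)) : ℝ) * (θ y * φ y) := by
    subst hep
    exact hw.integral_chart_eq hΩ p (hθ.mul hφ) hθc.mul_right (hΦK.trans hKe) (hΦK.trans hKΩ) i
  have hder : ∀ y, fderiv ℝ (fun y => θ y * φ y) y (EuclideanSpace.single i (1 : ℝ)) =
      θ y * fderiv ℝ φ y (EuclideanSpace.single i (1 : ℝ)) +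
        φ y * fderiv ℝ θ y (EuclideanSpace.single i (1 : ℝ)) := by
    intro y
    rw [fderiv_fun_mul (hθ.contDiffAt.differentiableAt (by simp))
      (hφ.contDiffAt.differentiableAt (by simp))]
    simp
  rw [setIntegral_eq_integral_of_forall_compl_eq_zero,
    setIntegral_eq_integral_of_forall_compl_eq_zero] at h
  · have hi1 := hA.integrable_mul hdφ2
    have hi2 := (hB i).integrable_mul hφ2
    have hi3 := (hD i).integrable_mul hφ2
    have h1 := integral_add hi1 hi2
    have h2 := integral_add hi2 hi3
    simp only [Pi.mul_apply] at h1 h2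
    have h3 : ∫ y, w (e.symm y) * fderiv ℝ (fun y => θ y * φ y) y (EuclideanSpace.single i (1 : ℝ)) =
        ∫ y, (θ y * w (e.symm y) * fderiv ℝ φ y (EuclideanSpace.single i (1 : ℝ)) +
          w (e.symm y) * fderiv ℝ θ y (EuclideanSpace.single i (1 : ℝ)) * φ y) := by
      refine integral_congr_ae (.of_forall fun y => ?_)
      simp only [hder]
      ring
    have h4 : ∫ y, (inner ℝ (X (e.symm y)) (frame e i (e.symm y)) : ℝ) * (θ y * φ y) =
        ∫ y, (θ y * inner ℝ (X (e.symm y)) (frame e i (e.symm y))) * φ y := by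
      refine integral_congr_ae (.of_forall fun y => ?_)
      simp only
      ring
    simp_rw [add_mul]
    rw [h3, h4, h1] at h
    rw [h2]
    linarith
  · intro y hy
    rw [hθ0 y fun hyK => hy (hKe hyK), zero_mul, mul_zero]
  · intro y hy
    rw [hder, hθ0 y fun hyK => hy (hKe hyK),
      hdθ0 i y fun hyK => hy (hKe hyK), zero_mul, mul_zero, add_zero, mul_zero]

/-- In coordinates ψw becomes a compactly supported W^{1,2} function of the plane. Its
mollifications, extended by zero to M, are test functions of Ω, and both errors are transported back
with constants depending only on the compact set K′. -/
theorem HasWeakGradient.isApproximable_of_chart (hΩ : IsOpen Ω) (hw : HasWeakGradient Ω w X)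
    (p : M) (hψ : IsTestFunction Ω ψ) (hψp : tsupport ψ ⊆ (chartAt Plane p).source) :
    IsApproximable Ω w X ψ := by
  set e := chartAt Plane p with hep
  have he : e ∈ IsManifold.maximalAtlas (𝓡 2) ∞ M := IsManifold.chart_mem_maximalAtlas p
  obtain ⟨hK, hKe, hθ, hθ0⟩ := contDiff_chart_extension he hψ.smooth hψ.compact hψp
  generalize hθ_def : e.target.indicator (ψ ∘ e.symm) = θ at hθ hθ0
  have hθe : ∀ y ∈ e.target, θ y = ψ (e.symm y) := fun y hy => by
    rw [← hθ_def, Set.indicator_of_mem hy]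
    rfl
  have hsymm : e.symm '' (e '' tsupport ψ) = tsupport ψ := by
    rw [Set.image_image]
    exact (Set.image_congr fun x hx => e.left_inv (hψp hx)).trans (Set.image_id _)
  have hKΩ : e '' tsupport ψ ⊆ e.symm ⁻¹' Ω := by
    rw [← Set.image_subset_iff, hsymm]
    exact hψ.support_subset
  generalize e '' tsupport ψ = K at hK hKe hθ0 hsymm hKΩ
  obtain ⟨hv, hg, hweak⟩ := hw.memLp_chart hΩ p hep hK hKe hKΩ hθ hθ0
  obtain ⟨K', hK', hKK', hK'U, happ⟩ := exists_contDiff_approx hK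
    (e.isOpen_inter_preimage_symm hΩ) (Set.subset_inter hKe hKΩ) hv hg
    (fun y hy => by rw [hθ0 y hy, zero_mul]) hweak
  have hK'e : K' ⊆ e.target := hK'U.trans Set.inter_subset_left
  obtain ⟨C₁, hC₁, hbound⟩ := exists_eLpNorm_vol_le p hK' hK'e
  obtain ⟨C₂, hC₂, hnorm⟩ := exists_norm_le_inner_frame he hK' hK'e
  intro ε hε
  -- D dominates the constant C₁ for the functions and the constant 2C₁C₂ for the gradients, the 2
  -- counting the partial derivatives. A tolerance ε/D in the plane therefore gives ε on M.
  set D : ℝ≥0∞ := C₁ * (1 + ENNReal.ofReal C₂ * 2) + 1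
  have hD : D ≠ ⊤ := by
    simp only [D]
    finiteness
  have hDε : D * (ε / D) ≤ ε := ENNReal.mul_div_le
  obtain ⟨φ, hφ, hφK', hφv, hφg⟩ := happ (ε / D) (by simp [hε, hD])
  obtain ⟨hu, hu0⟩ := isTestFunction_chart_pullback he hφ hK' hφK' hK'U
  generalize hu_def : e.source.indicator (φ ∘ e) = u at hu hu0
  have hue : ∀ y ∈ e.target, u (e.symm y) = φ y := fun y hy => by
    rw [← hu_def, Set.indicator_of_mem (e.map_target hy), Function.comp_apply, e.right_inv hy]
  have hK'M : IsCompact (e.symm '' K') := isCompact_symm_image hK' hK'e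
  have hψ0 : ∀ x ∉ e.symm '' K', x ∉ tsupport ψ := fun x hx h =>
    hx (Set.image_mono hKK' (hsymm ▸ h))
  refine ⟨u, hu, ?_, ?_⟩
  · refine (hbound (fun x => u x - ψ x * w x) fun x hx => ?_).trans ?_
    · rw [hu0 x hx, image_eq_zero_of_notMem_tsupport (hψ0 x hx), zero_mul, sub_zero]
    · calc C₁ * eLpNorm (fun y => u (e.symm y) - ψ (e.symm y) * w (e.symm y)) 2
            (volume.restrict K')
          = C₁ * eLpNorm (fun y => φ y - θ y * w (e.symm y)) 2 (volume.restrict K') := by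
            congr 1
            refine eLpNorm_congr_ae ((ae_restrict_iff' hK'.measurableSet).2
              (.of_forall fun y hy => ?_))
            simp only
            rw [hue y (hK'e hy), hθe y (hK'e hy)]
        _ ≤ C₁ * (ε / D) := by
            gcongr
            exact (eLpNorm_restrict_le _ _ _ _).trans hφv
        _ ≤ D * (ε / D) := by
            gcongr
            calc C₁ = C₁ * 1 := (mul_one _).symm
              _ ≤ C₁ * (1 + ENNReal.ofReal C₂ * 2) := by
                gcongr
                exact le_self_add
              _ ≤ D := le_self_add
        _ ≤ ε := hDε
  · refine (hbound (fun x => ‖grad u x - (ψ x • X x + w x • grad ψ x)‖) fun x hx => ?_).trans ?_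
    · have h1 : grad u x = 0 := by
        refine (grad_congr (v := fun _ => 0) ?_).trans (grad_const 0 x)
        filter_upwards [hK'M.isClosed.isOpen_compl.mem_nhds hx] with z hz using hu0 z hz
      rw [h1, image_eq_zero_of_notMem_tsupport (hψ0 x hx), grad_of_notMem_tsupport (hψ0 x hx),
        zero_smul, smul_zero, add_zero, sub_zero, norm_zero]
    · set d : Fin 2 → Plane → ℝ := fun i y => fderiv ℝ φ y (EuclideanSpace.single i (1 : ℝ)) -
        (w (e.symm y) * fderiv ℝ θ y (EuclideanSpace.single i (1 : ℝ)) +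
          θ y * inner ℝ (X (e.symm y)) (frame e i (e.symm y))) with hd_def
      have hdm : ∀ i, AEStronglyMeasurable (d i) volume := fun i =>
        ((hφ.continuous_fderiv (by simp)).clm_apply
          continuous_const).aestronglyMeasurable.sub (hg i).1
      have hinner : ∀ y ∈ K', ∀ i : Fin 2, (inner ℝ (grad u (e.symm y) - (ψ (e.symm y) •
          X (e.symm y) + w (e.symm y) • grad ψ (e.symm y))) (frame e i (e.symm y)) : ℝ) =
          d i y := by
        intro y hy i
        have hye := hK'e hy
        have hev : ∀ᶠ z in nhds y, z ∈ e.target := e.open_target.eventually_mem hye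
        have h1 : u ∘ e.symm =ᶠ[nhds y] φ := by
          filter_upwards [hev] with z hz using hue z hz
        have h2 : ψ ∘ e.symm =ᶠ[nhds y] θ := by
          filter_upwards [hev] with z hz using (hθe z hz).symm
        rw [inner_sub_left, inner_add_left, real_inner_smul_left, real_inner_smul_left,
          inner_grad_frame he (e.map_target hye) (hu.smooth.mdifferentiable (by simp) _),
          inner_grad_frame he (e.map_target hye) (hψ.smooth.mdifferentiable (by simp) _),
          e.right_inv hye, h1.fderiv_eq, h2.fderiv_eq, ← hθe y hye, hd_def]
        ring
      have hsum : eLpNorm (fun y => |d 0 y| + |d 1 y|) 2 ≤ ε / D + ε / D := by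
        refine (eLpNorm_add_le (hdm 0).norm (hdm 1).norm (by norm_num)).trans ?_
        rw [eLpNorm_norm, eLpNorm_norm]
        exact add_le_add (hφg 0) (hφg 1)
      calc C₁ * eLpNorm (fun y => ‖grad u (e.symm y) - (ψ (e.symm y) • X (e.symm y) +
            w (e.symm y) • grad ψ (e.symm y))‖) 2 (volume.restrict K')
          ≤ C₁ * eLpNorm (C₂ • fun y => |d 0 y| + |d 1 y|) 2 (volume.restrict K') := by
            gcongr
            refine eLpNorm_mono_ae ((ae_restrict_iff' hK'.measurableSet).2
              (.of_forall fun y hy => ?_))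
            have h := hnorm (fun x => grad u x - (ψ x • X x + w x • grad ψ x)) y hy
            rw [hinner y hy 0, hinner y hy 1] at h
            rw [norm_norm]
            exact h.trans (Real.le_norm_self _)
        _ = C₁ * (ENNReal.ofReal C₂ *
              eLpNorm (fun y => |d 0 y| + |d 1 y|) 2 (volume.restrict K')) := by
            rw [eLpNorm_const_smul, Real.enorm_of_nonneg hC₂]
        _ ≤ C₁ * (ENNReal.ofReal C₂ * (ε / D + ε / D)) := by
            gcongr
            exact (eLpNorm_restrict_le _ _ _ _).trans hsum
        _ = C₁ * (ENNReal.ofReal C₂ * 2) * (ε / D) := by ring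
        _ ≤ D * (ε / D) := by
            gcongr
            refine le_trans ?_ le_self_add
            gcongr
            exact le_add_self
        _ ≤ ε := hDε

end WeightedCKN

/-! ### Limits of integrals of products, and gluing of approximations by a partition of unity. -/

namespace WeightedCKN

variable {M : Type*} [TopologicalSpace M] [ChartedSpace Plane M]

/-- The integral of a product is the scalar product of L², which is jointly continuous. -/
theorem tendsto_integral_mul {α : Type*} [MeasurableSpace α] {μ : Measure α} {a b : α → ℝ}
    {a' b' : ℕ → α → ℝ} (ha : MemLp a 2 μ) (hb : MemLp b 2 μ) (ha' : ∀ n, MemLp (a' n) 2 μ)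
    (hb' : ∀ n, MemLp (b' n) 2 μ)
    (hA : Filter.Tendsto (fun n => eLpNorm (fun x => a' n x - a x) 2 μ) Filter.atTop (nhds 0))
    (hB : Filter.Tendsto (fun n => eLpNorm (fun x => b' n x - b x) 2 μ) Filter.atTop (nhds 0)) :
    Filter.Tendsto (fun n => ∫ x, a' n x * b' n x ∂μ) Filter.atTop (nhds (∫ x, a x * b x ∂μ)) := by
  have key : ∀ {f g : α → ℝ} (hf : MemLp f 2 μ) (hg : MemLp g 2 μ),
      ∫ x, f x * g x ∂μ = inner ℝ (hg.toLp g) (hf.toLp f) := by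
    intro f g hf hg
    rw [L2.inner_def]
    refine integral_congr_ae ?_
    filter_upwards [hf.coeFn_toLp, hg.coeFn_toLp] with x h1 h2
    rw [h1, h2]
    simp
  rw [key ha hb]
  simp_rw [fun n => key (ha' n) (hb' n)]
  exact ((Lp.tendsto_Lp_iff_tendsto_eLpNorm'' b' hb' b hb).2 hB).inner
    ((Lp.tendsto_Lp_iff_tendsto_eLpNorm'' a' ha' a ha).2 hA)

theorem memLp_mul_of_restrict {N : Type*} [TopologicalSpace N] [MeasurableSpace N] [BorelSpace N]
    [T2Space N] {μ : Measure N} {b q : N → ℝ} {K : Set N} (hb : Continuous b) (hK : IsCompact K)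
    (hb0 : ∀ x ∉ K, b x = 0) (hq : MemLp q 2 (μ.restrict K)) :
    MemLp (fun x => b x * q x) 2 μ := by
  have h := ((memLp_indicator_iff_restrict hK.measurableSet).2 hq).mul'
    (hb.memLp_top_of_hasCompactSupport (HasCompactSupport.intro hK hb0) μ) (r := 2)
  refine (memLp_congr_ae (.of_forall fun x => ?_)).1 h
  by_cases hx : x ∈ K
  · simp only [Set.indicator_of_mem hx]
  · simp only [hb0 x hx, zero_mul]

section Approximation

variable [RiemannianBundle (fun x : M => TangentSpace (𝓡 2) x)] [MeasurableSpace M]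
  {Ω : Set M} {w : M → ℝ} {X : Π x : M, TangentSpace (𝓡 2) x} {ψ : M → ℝ}

theorem isApproximable_zero : IsApproximable Ω w X (fun _ => 0) := by
  intro ε _
  refine ⟨fun _ => 0, isTestFunction_zero, ?_, ?_⟩
  · simp
  · simp [grad_const]

variable [IsManifold (𝓡 2) ∞ M] [BorelSpace M]

theorem HasWeakGradient.aestronglyMeasurable_mul (hΩ : IsOpen Ω)
    (hw : HasWeakGradient Ω w X) (hψ : IsTestFunction Ω ψ) :
    AEStronglyMeasurable (fun x => ψ x * w x) (vol M) :=
  aestronglyMeasurable_of_restrict hΩ.measurableSet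
    (hψ.smooth.continuous.aestronglyMeasurable.mul hw.aestronglyMeasurable)
    fun x hx => by rw [hψ.eq_zero hx, zero_mul]

variable [SecondCountableTopology M]
  [IsContMDiffRiemannianBundle (𝓡 2) ∞ Plane (fun x : M => TangentSpace (𝓡 2) x)]

theorem HasWeakGradient.aestronglyMeasurable_norm_sub (hΩ : IsOpen Ω)
    -- X is not assumed measurable as a section; only |X| and its products with test fields are
    -- known to be measurable. The squared norm is therefore expanded into scalar products of these
    -- kinds.
    (hw : HasWeakGradient Ω w X) {u : M → ℝ} (hu : IsTestFunction Ω u)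
    (hψ : IsTestFunction Ω ψ) :
    AEStronglyMeasurable (fun x => ‖grad u x - (ψ x • X x + w x • grad ψ x)‖) (vol M) := by
  have hA := hu.isTestField_grad
  have hB := hψ.isTestField_grad
  refine aestronglyMeasurable_of_restrict hΩ.measurableSet ?_ fun x hx => ?_
  · have hψm : AEStronglyMeasurable ψ ((vol M).restrict Ω) :=
      hψ.smooth.continuous.aestronglyMeasurable
    have h1 : AEStronglyMeasurable (fun x => (inner ℝ (X x) (grad u x) : ℝ))
        ((vol M).restrict Ω) := (hw.integrable_inner _ hA).aestronglyMeasurable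
    have h2 : AEStronglyMeasurable (fun x => (inner ℝ (X x) (grad ψ x) : ℝ))
        ((vol M).restrict Ω) := (hw.integrable_inner _ hB).aestronglyMeasurable
    have h3 : AEStronglyMeasurable (fun x => (inner ℝ (grad u x) (grad u x) : ℝ))
        ((vol M).restrict Ω) := (continuous_inner_field hA.smooth hA.smooth).aestronglyMeasurable
    have h4 : AEStronglyMeasurable (fun x => (inner ℝ (grad u x) (grad ψ x) : ℝ))
        ((vol M).restrict Ω) := (continuous_inner_field hA.smooth hB.smooth).aestronglyMeasurable
    have h5 : AEStronglyMeasurable (fun x => (inner ℝ (grad ψ x) (grad ψ x) : ℝ))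
        ((vol M).restrict Ω) := (continuous_inner_field hB.smooth hB.smooth).aestronglyMeasurable
    have h6 := hw.aestronglyMeasurable_norm
    have hwm := hw.aestronglyMeasurable
    have h := Real.continuous_sqrt.comp_aestronglyMeasurable
      ((h3.sub ((hψm.mul h1).const_mul 2)).sub ((hwm.mul h4).const_mul 2) |>.add
        (((hψm.mul h6).pow 2).add (((hψm.mul hwm).mul h2).const_mul 2)) |>.add ((hwm.pow 2).mul h5))
    refine h.congr (.of_forall fun x => ?_)
    simp only [norm_eq_sqrt_real_inner (grad u x - _)]
    congr 1
    simp only [Pi.add_apply, Pi.sub_apply, Pi.mul_apply, Pi.pow_apply, inner_sub_left,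
      inner_sub_right, inner_add_left, inner_add_right, real_inner_smul_left,
      real_inner_smul_right, mul_pow, ← real_inner_self_eq_norm_sq]
    rw [real_inner_comm (X x) (grad u x), real_inner_comm (grad u x) (grad ψ x),
      real_inner_comm (X x) (grad ψ x)]
    ring
  · rw [hA.eq_zero hx, hB.eq_zero hx, hψ.eq_zero hx, zero_smul, smul_zero, add_zero, sub_zero,
      norm_zero]

theorem IsApproximable.add (hΩ : IsOpen Ω) (hw : HasWeakGradient Ω w X) {ψ₁ ψ₂ : M → ℝ}
    (hψ₁ : IsTestFunction Ω ψ₁) (hψ₂ : IsTestFunction Ω ψ₂) (h₁ : IsApproximable Ω w X ψ₁)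
    (h₂ : IsApproximable Ω w X ψ₂) : IsApproximable Ω w X (fun x => ψ₁ x + ψ₂ x) := by
  intro ε hε
  obtain ⟨u₁, hu₁, ha₁, hb₁⟩ := h₁ (ε / 2) (by simp [hε])
  obtain ⟨u₂, hu₂, ha₂, hb₂⟩ := h₂ (ε / 2) (by simp [hε])
  refine ⟨fun x => u₁ x + u₂ x, hu₁.add hu₂, ?_, ?_⟩
  · calc eLpNorm (fun x => u₁ x + u₂ x - (ψ₁ x + ψ₂ x) * w x) 2 (vol M)
        = eLpNorm ((fun x => u₁ x - ψ₁ x * w x) + fun x => u₂ x - ψ₂ x * w x) 2 (vol M) := by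
          congr 1
          funext x
          simp only [Pi.add_apply]
          ring
      _ ≤ ε / 2 + ε / 2 := (eLpNorm_add_le
          (hu₁.smooth.continuous.aestronglyMeasurable.sub (hw.aestronglyMeasurable_mul hΩ hψ₁))
          (hu₂.smooth.continuous.aestronglyMeasurable.sub (hw.aestronglyMeasurable_mul hΩ hψ₂))
          (by norm_num)).trans (add_le_add ha₁ ha₂)
      _ = ε := ENNReal.add_halves ε
  · calc eLpNorm (fun x => ‖grad (fun x => u₁ x + u₂ x) x - ((ψ₁ x + ψ₂ x) • X x +
          w x • grad (fun x => ψ₁ x + ψ₂ x) x)‖) 2 (vol M)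
        ≤ eLpNorm ((fun x => ‖grad u₁ x - (ψ₁ x • X x + w x • grad ψ₁ x)‖) +
          fun x => ‖grad u₂ x - (ψ₂ x • X x + w x • grad ψ₂ x)‖) 2 (vol M) := by
          refine eLpNorm_mono_real fun x => ?_
          rw [norm_norm, grad_add (hu₁.smooth.mdifferentiable (by simp) x)
            (hu₂.smooth.mdifferentiable (by simp) x),
            grad_add (hψ₁.smooth.mdifferentiable (by simp) x)
            (hψ₂.smooth.mdifferentiable (by simp) x)]
          refine le_trans (le_of_eq ?_) (norm_add_le _ _)
          congr 1
          module
      _ ≤ ε / 2 + ε / 2 := (eLpNorm_add_le (hw.aestronglyMeasurable_norm_sub hΩ hu₁ hψ₁)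
          (hw.aestronglyMeasurable_norm_sub hΩ hu₂ hψ₂) (by norm_num)).trans (add_le_add hb₁ hb₂)
      _ = ε := ENNReal.add_halves ε

theorem isApproximable_sum {ι : Type*} (hΩ : IsOpen Ω) (hw : HasWeakGradient Ω w X)
    (s : Finset ι) (ψ : ι → M → ℝ) (hψ : ∀ i, IsTestFunction Ω (ψ i))
    (h : ∀ i, IsApproximable Ω w X (ψ i)) :
    IsTestFunction Ω (fun x => ∑ i ∈ s, ψ i x) ∧
      IsApproximable Ω w X (fun x => ∑ i ∈ s, ψ i x) := by
  classical
  induction s using Finset.induction_on with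
  | empty => exact ⟨by simpa using isTestFunction_zero, by simpa using isApproximable_zero⟩
  | insert i s hi ih =>
    simp_rw [Finset.sum_insert hi]
    exact ⟨(hψ i).add ih.1, (h i).add hΩ hw (hψ i) ih.1 ih.2⟩

variable [T2Space M]

/-- Products of functions in `W^{1,2}_loc` and of test functions are limits of test functions
in `W^{1,2}`. -/
theorem HasWeakGradient.isApproximable (hΩ : IsOpen Ω) (hw : HasWeakGradient Ω w X)
    (hψ : IsTestFunction Ω ψ) : IsApproximable Ω w X ψ := by
  have : LocallyCompactSpace M := ChartedSpace.locallyCompactSpace Plane M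
  obtain ⟨f, hf⟩ := SmoothPartitionOfUnity.exists_isSubordinate (𝓡 2) (isClosed_tsupport ψ)
    (fun p : M => (chartAt Plane p).source) (fun p => (chartAt Plane p).open_source)
    (fun x _ => Set.mem_iUnion.2 ⟨x, mem_chart_source Plane x⟩)
  -- Only finitely many members of the partition meet the compact support of ψ, so ψ is a finite sum
  -- of test functions each supported in one chart.
  have hfin := f.locallyFinite.finite_nonempty_inter_compact hψ.compact
  have hsum : ψ = fun x => ∑ p ∈ hfin.toFinset, f p x * ψ x := by
    funext x
    by_cases hx : x ∈ tsupport ψ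
    · rw [← Finset.sum_mul, ← finsum_eq_sum_of_support_subset (fun p => f p x), f.sum_eq_one hx,
        one_mul]
      intro p hp
      rw [Set.Finite.coe_toFinset]
      exact ⟨x, hp, hx⟩
    · simp [image_eq_zero_of_notMem_tsupport hx]
  have htest : ∀ p, IsTestFunction Ω (fun x => f p x * ψ x) :=
    fun p => hψ.mul_left (f p).contMDiff
  rw [hsum]
  exact (isApproximable_sum hΩ hw _ _ htest fun p => hw.isApproximable_of_chart hΩ p (htest p)
    (tsupport_mul_subset_left.trans (hf p))).2

end Approximation

end WeightedCKN

/-! ### The Rayleigh bound, integration by parts against w², and the inequality. -/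

namespace WeightedCKN

variable {M : Type*} [TopologicalSpace M] [ChartedSpace Plane M]

theorem tendsto_eLpNorm_zero_of_le {α : Type*} [MeasurableSpace α] {μ : Measure α} {C : ℝ}
    {a b : ℕ → α → ℝ} (hb : Filter.Tendsto (fun n => eLpNorm (b n) 2 μ) Filter.atTop (nhds 0))
    (h : ∀ n x, |a n x| ≤ C * |b n x|) :
    Filter.Tendsto (fun n => eLpNorm (a n) 2 μ) Filter.atTop (nhds 0) := by
  refine tendsto_of_tendsto_of_tendsto_of_le_of_le tendsto_const_nhds
    (h := fun n => ENNReal.ofReal C * eLpNorm (b n) 2 μ) ?_ (fun _ => zero_le)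
    fun n => eLpNorm_le_mul_eLpNorm_of_ae_le_mul (.of_forall (h n)) 2
  simpa using ENNReal.Tendsto.const_mul hb (Or.inr ENNReal.ofReal_ne_top)

section Inequality

variable [RiemannianBundle (fun x : M => TangentSpace (𝓡 2) x)] [IsManifold (𝓡 2) ∞ M]
  {Ω : Set M} {w : M → ℝ} {X : Π x : M, TangentSpace (𝓡 2) x} {ψ : M → ℝ}

section

variable [T2Space M]
  [IsContMDiffRiemannianBundle (𝓡 2) ∞ Plane (fun x : M => TangentSpace (𝓡 2) x)]

theorem IsTestField.exists_norm_le {Y : Π x : M, TangentSpace (𝓡 2) x} (hY : IsTestField Ω Y) :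
    ∃ C : ℝ, ∀ x, ‖Y x‖ ≤ C := by
  obtain ⟨K, hK, -, h0⟩ := hY.compact
  obtain ⟨C, hC⟩ := (continuous_norm_field hY.smooth).bounded_above_of_compact_support
    (HasCompactSupport.intro hK fun x hx => by rw [h0 x hx, norm_zero])
  exact ⟨C, fun x => by simpa using hC x⟩

end

variable [MeasurableSpace M]

section

variable [IsContMDiffRiemannianBundle (𝓡 2) ∞ Plane (fun x : M => TangentSpace (𝓡 2) x)]

theorem IsTestFunction.firstDirichletEigenvalue_mul_le {u : M → ℝ} (hu : IsTestFunction Ω u) :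
    firstDirichletEigenvalue Ω * ∫ x, u x ^ 2 ∂(vol M) ≤ ∫ x, ‖grad u x‖ ^ 2 ∂(vol M) := by
  have h1 : ∫ x in Ω, u x ^ 2 ∂(vol M) = ∫ x, u x ^ 2 ∂(vol M) :=
    setIntegral_eq_integral_of_forall_compl_eq_zero fun x hx => by simp [hu.eq_zero hx]
  have h2 : ∫ x in Ω, ‖grad u x‖ ^ 2 ∂(vol M) = ∫ x, ‖grad u x‖ ^ 2 ∂(vol M) :=
    setIntegral_eq_integral_of_forall_compl_eq_zero fun x hx => by
      simp [hu.isTestField_grad.eq_zero hx]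
  have hg : 0 ≤ ∫ x, ‖grad u x‖ ^ 2 ∂(vol M) := integral_nonneg fun x => sq_nonneg _
  have hn : 0 ≤ ∫ x, u x ^ 2 ∂(vol M) := integral_nonneg fun x => sq_nonneg _
  -- If ∫u² = 0 the left side vanishes and no quotient is needed; otherwise u ≠ 0 and its quotient
  -- belongs to the set defining the infimum.
  rcases hn.eq_or_lt with h0 | h0
  · rwa [← h0, mul_zero]
  · rw [← le_div_iff₀ h0, ← h1, ← h2]
    refine csInf_le ⟨0, ?_⟩ ⟨u, hu, ?_, rfl⟩
    · rintro r ⟨v, -, -, rfl⟩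
      exact div_nonneg (integral_nonneg fun x => sq_nonneg _) (integral_nonneg fun x => sq_nonneg _)
    · rintro rfl
      simp at h0

end

variable [BorelSpace M]

section

variable [IsContMDiffRiemannianBundle (𝓡 2) ∞ Plane (fun x : M => TangentSpace (𝓡 2) x)]

theorem IsTestFunction.memLp {u : M → ℝ} (hu : IsTestFunction Ω u) : MemLp u 2 (vol M) :=
  hu.smooth.continuous.memLp_of_hasCompactSupport hu.compact

end

variable [T2Space M]

theorem HasWeakGradient.memLp_mul (hw : HasWeakGradient Ω w X) (hψ : IsTestFunction Ω ψ) :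
    MemLp (fun x => ψ x * w x) 2 (vol M) :=
  memLp_mul_of_restrict hψ.smooth.continuous hψ.compact
    (fun _ hx => image_eq_zero_of_notMem_tsupport hx)
    (hw.memLp_restrict hψ.compact hψ.support_subset)

section

variable [IsContMDiffRiemannianBundle (𝓡 2) ∞ Plane (fun x : M => TangentSpace (𝓡 2) x)]

theorem IsTestField.memLp_norm {Y : Π x : M, TangentSpace (𝓡 2) x} (hY : IsTestField Ω Y) :
    MemLp (fun x => ‖Y x‖) 2 (vol M) := by
  obtain ⟨K, hK, -, h0⟩ := hY.compact
  exact (continuous_norm_field hY.smooth).memLp_of_hasCompactSupport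
    (HasCompactSupport.intro hK fun x hx => by rw [h0 x hx, norm_zero])

theorem HasWeakGradient.memLp_norm_field_mul (hw : HasWeakGradient Ω w X)
    {Y : Π x : M, TangentSpace (𝓡 2) x} (hY : IsTestField Ω Y) :
    MemLp (fun x => ‖Y x‖ * w x) 2 (vol M) := by
  obtain ⟨K, hK, hKΩ, h0⟩ := hY.compact
  exact memLp_mul_of_restrict (continuous_norm_field hY.smooth) hK
    (fun x hx => by rw [h0 x hx, norm_zero]) (hw.memLp_restrict hK hKΩ)

end

variable [SecondCountableTopology M]

theorem HasWeakGradient.memLp_norm_mul (hw : HasWeakGradient Ω w X) (hψ : IsTestFunction Ω ψ) :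
    MemLp (fun x => ψ x * ‖X x‖) 2 (vol M) :=
  memLp_mul_of_restrict hψ.smooth.continuous hψ.compact
    (fun _ hx => image_eq_zero_of_notMem_tsupport hx)
    (hw.memLp_norm_restrict hψ.compact hψ.support_subset)

variable [IsContMDiffRiemannianBundle (𝓡 2) ∞ Plane (fun x : M => TangentSpace (𝓡 2) x)]

theorem HasWeakGradient.memLp_inner (hΩ : IsOpen Ω) (hw : HasWeakGradient Ω w X)
    {Y : Π x : M, TangentSpace (𝓡 2) x} (hY : IsTestField Ω Y) :
    MemLp (fun x => (inner ℝ (X x) (Y x) : ℝ)) 2 (vol M) := by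
  obtain ⟨K, hK, hKΩ, h0⟩ := hY.compact
  have h := memLp_mul_of_restrict (continuous_norm_field hY.smooth) hK
    (fun x hx => by rw [h0 x hx, norm_zero]) (hw.memLp_norm_restrict hK hKΩ)
  refine h.mono (aestronglyMeasurable_of_restrict hΩ.measurableSet
    (hw.integrable_inner Y hY).aestronglyMeasurable fun x hx => ?_) (.of_forall fun x => ?_)
  · rw [hY.eq_zero hx, inner_zero_right]
  · rw [norm_mul, norm_norm, norm_norm, mul_comm]
    exact abs_real_inner_le_norm _ _

theorem HasWeakGradient.memLp_norm_smul_add (hΩ : IsOpen Ω) (hw : HasWeakGradient Ω w X)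
    (hψ : IsTestFunction Ω ψ) : MemLp (fun x => ‖ψ x • X x + w x • grad ψ x‖) 2 (vol M) := by
  refine ((hw.memLp_norm_mul hψ).norm.add
    (hw.memLp_norm_field_mul hψ.isTestField_grad).norm).mono' ?_ (.of_forall fun x => ?_)
  -- Measurability is the case u = 0 of the lemma on the approximation error.
  · refine (hw.aestronglyMeasurable_norm_sub hΩ isTestFunction_zero hψ).congr
      (.of_forall fun x => ?_)
    simp only [grad_const, zero_sub, norm_neg]
  · rw [norm_norm]
    refine (norm_add_le _ _).trans (le_of_eq ?_)
    simp only [Pi.add_apply, norm_smul, norm_mul, norm_norm, mul_comm]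

theorem HasWeakGradient.exists_seq (hΩ : IsOpen Ω) (hw : HasWeakGradient Ω w X)
    (hψ : IsTestFunction Ω ψ) : ∃ u : ℕ → M → ℝ, (∀ n, IsTestFunction Ω (u n)) ∧
      Filter.Tendsto (fun n => eLpNorm (fun x => u n x - ψ x * w x) 2 (vol M))
        Filter.atTop (nhds 0) ∧
      Filter.Tendsto (fun n => eLpNorm
        (fun x => ‖grad (u n) x - (ψ x • X x + w x • grad ψ x)‖) 2 (vol M))
        Filter.atTop (nhds 0) := by
  choose u hu h1 h2 using fun n : ℕ => hw.isApproximable hΩ hψ (n : ℝ≥0∞)⁻¹ (by simp)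
  exact ⟨u, hu,
    tendsto_of_tendsto_of_tendsto_of_le_of_le tendsto_const_nhds
      ENNReal.tendsto_inv_nat_nhds_zero (fun _ => zero_le) h1,
    tendsto_of_tendsto_of_tendsto_of_le_of_le tendsto_const_nhds
      ENNReal.tendsto_inv_nat_nhds_zero (fun _ => zero_le) h2⟩

/-- The Rayleigh quotient of `ψ w` is bounded below by the first Dirichlet eigenvalue. -/
theorem HasWeakGradient.firstDirichletEigenvalue_mul_le (hΩ : IsOpen Ω)
    (hw : HasWeakGradient Ω w X) (hψ : IsTestFunction Ω ψ) :
    firstDirichletEigenvalue Ω * ∫ x, (ψ x * w x) ^ 2 ∂(vol M) ≤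
      ∫ x, ‖ψ x • X x + w x • grad ψ x‖ ^ 2 ∂(vol M) := by
  obtain ⟨u, hu, h1, h2⟩ := hw.exists_seq hΩ hψ
  have ha := hw.memLp_mul hψ
  have hb := hw.memLp_norm_smul_add hΩ hψ
  -- By the reverse triangle inequality the norms of the gradients converge in L², so both sides of
  -- the inequality for test functions pass to the limit.
  have h3 : Filter.Tendsto (fun n => eLpNorm (fun x => ‖grad (u n) x‖ -
      ‖ψ x • X x + w x • grad ψ x‖) 2 (vol M)) Filter.atTop (nhds 0) :=
    tendsto_eLpNorm_zero_of_le (C := 1) h2 fun n x => by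
      rw [one_mul, abs_norm]
      exact abs_norm_sub_norm_le _ _
  have hl := tendsto_integral_mul ha ha (fun n => (hu n).memLp) (fun n => (hu n).memLp) h1 h1
  have hr := tendsto_integral_mul hb hb (fun n => (hu n).isTestField_grad.memLp_norm)
    (fun n => (hu n).isTestField_grad.memLp_norm) h3 h3
  simp_rw [sq]
  refine le_of_tendsto_of_tendsto' (hl.const_mul _) hr fun n => ?_
  simpa only [sq] using (hu n).firstDirichletEigenvalue_mul_le

/-- Integration by parts against the square of a function in `W^{1,2}_loc`. -/
theorem HasWeakGradient.integral_sq_mul_divergence (hΩ : IsOpen Ω)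
    (hw : HasWeakGradient Ω w X) {Y : Π x : M, TangentSpace (𝓡 2) x} (hY : IsTestField Ω Y) :
    ∫ x, w x ^ 2 * divergence Y x ∂(vol M) =
      -(2 * ∫ x, w x * (inner ℝ (X x) (Y x) : ℝ) ∂(vol M)) := by
  have : LocallyCompactSpace M := ChartedSpace.locallyCompactSpace Plane M
  obtain ⟨K, hK, hKΩ, h0⟩ := hY.compact
  obtain ⟨L, hL, hKL, hLΩ⟩ := exists_compact_between hK hΩ hKΩ
  -- The cut-off χ equals 1 near the support set K of Y. There χw and its gradient χX + w∇χ agree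
  -- with w and X, while χw can be approximated globally by test functions.
  obtain ⟨χ, hχ1, hχ0, -⟩ := exists_contMDiffMap_one_nhds_of_subset_interior (𝓡 2) (n := ⊤)
    hK.isClosed hKL
  have hχ : IsTestFunction Ω χ :=
    ⟨χ.contMDiff, HasCompactSupport.intro hL hχ0,
      (closure_minimal (s := Function.support χ)
        (fun x hx => by_contra fun h => hx (hχ0 x h)) hL.isClosed).trans hLΩ⟩
  have hχK : ∀ x ∈ K, χ x = 1 ∧ grad χ x = 0 := fun x hx => by
    have h := Filter.Eventually.filter_mono (nhds_le_nhdsSet hx) hχ1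
    exact ⟨h.self_of_nhds, (grad_congr h).trans (grad_const 1 x)⟩
  obtain ⟨u, hu, h1, h2⟩ := hw.exists_seq hΩ hχ
  obtain ⟨C, hC⟩ := hY.exists_norm_le
  have hD : ∀ x ∉ K, divergence Y x = 0 := fun x hx => divergence_eq_zero hK h0 hx
  have hdw : MemLp (fun x => divergence Y x * w x) 2 (vol M) :=
    memLp_mul_of_restrict (continuous_divergence hY.smooth) hK hD (hw.memLp_restrict hK hKΩ)
  have hχw := hw.memLp_mul hχ
  have hXY := hw.memLp_inner hΩ hY
  have hgY : ∀ n, MemLp (fun x => (inner ℝ (grad (u n) x) (Y x) : ℝ)) 2 (vol M) := fun n =>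
    (continuous_inner_field (hu n).isTestField_grad.smooth hY.smooth).memLp_of_hasCompactSupport
      (HasCompactSupport.intro hK fun x hx => by rw [h0 x hx, inner_zero_right])
  have h3 : Filter.Tendsto (fun n => eLpNorm (fun x => (inner ℝ (grad (u n) x) (Y x) : ℝ) -
      inner ℝ (X x) (Y x)) 2 (vol M)) Filter.atTop (nhds 0) :=
    tendsto_eLpNorm_zero_of_le (C := C) h2 fun n x => by
      by_cases hx : x ∈ K
      · rw [(hχK x hx).1, (hχK x hx).2, smul_zero, add_zero, one_smul, ← inner_sub_left, abs_norm,
          mul_comm]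
        exact (abs_real_inner_le_norm _ _).trans (mul_le_mul_of_nonneg_left (hC x) (norm_nonneg _))
      · rw [h0 x hx, inner_zero_right, inner_zero_right, sub_zero, abs_zero]
        exact mul_nonneg ((norm_nonneg _).trans (hC x)) (abs_nonneg _)
  have hc : ∀ {a : M → ℝ}, Filter.Tendsto (fun _ : ℕ => eLpNorm (fun x => a x - a x) 2 (vol M))
      Filter.atTop (nhds 0) := by simp
  have e1 := tendsto_integral_mul hdw hχw (fun _ => hdw) (fun n => (hu n).memLp) hc h1
  have e2 := tendsto_integral_mul hχw hXY (fun _ => hχw) hgY hc h3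
  have e3 := tendsto_integral_mul hXY hχw (fun _ => hXY) (fun n => (hu n).memLp) hc h1
  -- The weak gradient is tested with the field uₙY, where uₙ → χw. Approximating only one factor of
  -- w² avoids a product rule for Sobolev functions. The factor χ may be inserted freely because Y
  -- vanishes off K, and it makes each factor square integrable on M.
  have key : ∀ n, ∫ x, divergence Y x * w x * u n x ∂(vol M) +
      ∫ x, χ x * w x * (inner ℝ (grad (u n) x) (Y x) : ℝ) ∂(vol M) =
      -∫ x, (inner ℝ (X x) (Y x) : ℝ) * u n x ∂(vol M) := fun n => by
    have h := hw.integral_eq' (hY.smul (hu n).smooth)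
    refine (integral_add (hdw.integrable_mul (hu n).memLp)
      (hχw.integrable_mul (hgY n))).symm.trans ?_
    refine Eq.trans (integral_congr_ae (.of_forall fun x => ?_)) (h.trans
      (congrArg Neg.neg (integral_congr_ae (.of_forall fun x => ?_))))
    · simp only [Pi.mul_apply]
      rw [divergence_smul (hu n).smooth hY.smooth]
      by_cases hx : x ∈ K
      · rw [(hχK x hx).1]
        ring
      · rw [hD x hx, h0 x hx, inner_zero_right]
        ring
    · simp only [real_inner_smul_right]
      ring
  -- In the limit ∫w² div Y + ∫w⟨X,Y⟩ = −∫w⟨X,Y⟩, which is the source of the factor 2.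
  have hlim := tendsto_nhds_unique ((e1.add e2).congr key) e3.neg
  have i1 : ∫ x, divergence Y x * w x * (χ x * w x) ∂(vol M) =
      ∫ x, w x ^ 2 * divergence Y x ∂(vol M) := integral_congr_ae (.of_forall fun x => by
    by_cases hx : x ∈ K
    · simp only [(hχK x hx).1]
      ring
    · simp only [hD x hx]
      ring)
  have i2 : ∫ x, χ x * w x * (inner ℝ (X x) (Y x) : ℝ) ∂(vol M) =
      ∫ x, w x * (inner ℝ (X x) (Y x) : ℝ) ∂(vol M) := integral_congr_ae (.of_forall fun x => by
    by_cases hx : x ∈ K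
    · simp only [(hχK x hx).1]
      ring
    · simp only [h0 x hx, inner_zero_right]
      ring)
  have i3 : ∫ x, (inner ℝ (X x) (Y x) : ℝ) * (χ x * w x) ∂(vol M) =
      ∫ x, w x * (inner ℝ (X x) (Y x) : ℝ) ∂(vol M) := by
    rw [← i2]
    exact integral_congr_ae (.of_forall fun x => mul_comm _ _)
  rw [i1, i2, i3] at hlim
  linarith

theorem IsWeight.integral_sq_mul_le (hΩ : IsOpen Ω) {κ : M → ℝ} (hw : IsWeight Ω κ w X)
    (hκ : ∀ᵐ x ∂((vol M).restrict Ω), κ x ≤ firstDirichletEigenvalue Ω) {f : M → ℝ}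
    (hf : IsTestFunction Ω f) :
    ∫ x in Ω, ‖X x‖ ^ 2 * |f x| ^ 2 ∂(vol M) ≤ ∫ x in Ω, w x ^ 2 * ‖grad f x‖ ^ 2 ∂(vol M) := by
  have hW := hw.hasWeakGradient
  have hφ : IsTestFunction Ω (fun x => f x * f x) := hf.mul_left hf.smooth
  have hG := hf.isTestField_grad
  have hGφ := hφ.isTestField_grad
  have hgrad : ∀ x, grad (fun x => f x * f x) x = f x • grad f x + f x • grad f x := fun x =>
    grad_mul (hf.smooth.mdifferentiable (by simp) x) (hf.smooth.mdifferentiable (by simp) x)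
  have hfw := hW.memLp_mul hf
  have hfX := hW.memLp_norm_mul hf
  have hgw := hW.memLp_norm_field_mul hG
  have hXG := hW.memLp_inner hΩ hG
  have iA : Integrable (fun x => ‖X x‖ ^ 2 * f x ^ 2) (vol M) :=
    (hfX.integrable_mul hfX).congr (.of_forall fun x => by simp only [Pi.mul_apply]; ring)
  have iW : Integrable (fun x => w x ^ 2 * f x ^ 2) (vol M) :=
    (hfw.integrable_mul hfw).congr (.of_forall fun x => by simp only [Pi.mul_apply]; ring)
  have iE : Integrable (fun x => w x ^ 2 * ‖grad f x‖ ^ 2) (vol M) :=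
    (hgw.integrable_mul hgw).congr (.of_forall fun x => by simp only [Pi.mul_apply]; ring)
  have iC : Integrable (fun x => w x * f x * (inner ℝ (X x) (grad f x) : ℝ)) (vol M) :=
    (hfw.integrable_mul hXG).congr (.of_forall fun x => by simp only [Pi.mul_apply]; ring)
  -- Here κw² is only locally integrable, so integrability comes from the bounded, compactly
  -- supported factor f² and not from a product of two L² functions.
  have iB : Integrable (fun x => κ x * w x ^ 2 * f x ^ 2) (vol M) := by
    have h := (hw.integrable_curvature.integrableOn_compact_subset hf.support_subset
      hf.compact).mul_continuousOn (hf.smooth.continuous.pow 2).continuousOn hf.compact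
    refine (integrableOn_iff_integrable_of_support_subset fun x hx => ?_).1 h
    refine by_contra fun h => hx ?_
    simp [image_eq_zero_of_notMem_tsupport h]
  obtain ⟨K, hK, hKΩ, hK0⟩ := hGφ.compact
  have iL : Integrable (fun x => w x ^ 2 * laplacian (fun x => f x * f x) x) (vol M) := by
    have hc : Continuous (laplacian fun x => f x * f x) := continuous_divergence hGφ.smooth
    have h := (hW.sq_integrable.integrableOn_compact_subset hKΩ hK).mul_continuousOn
      hc.continuousOn hK
    refine (integrableOn_iff_integrable_of_support_subset fun x hx => ?_).1 h
    refine by_contra fun h => hx ?_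
    simp [laplacian, divergence_eq_zero hK hK0 h]
  have hL : ∫ x, w x ^ 2 * laplacian (fun x => f x * f x) x ∂(vol M) =
      -(4 * ∫ x, w x * f x * (inner ℝ (X x) (grad f x) : ℝ) ∂(vol M)) := by
    have h : ∀ x, w x * (inner ℝ (X x) (grad (fun x => f x * f x) x) : ℝ) =
        2 * (w x * f x * (inner ℝ (X x) (grad f x) : ℝ)) := fun x => by
      rw [hgrad, inner_add_right, real_inner_smul_right]
      ring
    refine (hW.integral_sq_mul_divergence hΩ hGφ).trans ?_
    simp_rw [h]
    rw [integral_const_mul]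
    ring
  have hweak := hw.weak_equation _ hφ
  rw [setIntegral_eq_integral_of_forall_compl_eq_zero fun x hx => by
    rw [hφ.eq_zero hx, laplacian, hGφ.divergence_eq_zero hx]; ring] at hweak
  have hsplit : ∫ x, ((4 * ‖X x‖ ^ 2 - 2 * κ x * w x ^ 2) * (f x * f x) -
      w x ^ 2 * laplacian (fun x => f x * f x) x) ∂(vol M) =
      4 * ∫ x, ‖X x‖ ^ 2 * f x ^ 2 ∂(vol M) - 2 * ∫ x, κ x * w x ^ 2 * f x ^ 2 ∂(vol M) -
      ∫ x, w x ^ 2 * laplacian (fun x => f x * f x) x ∂(vol M) := by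
    rw [← integral_const_mul, ← integral_const_mul,
      ← integral_sub (iA.const_mul 4) (iB.const_mul 2)]
    refine Eq.trans (integral_congr_ae (.of_forall fun x => ?_))
      (integral_sub ((iA.const_mul 4).sub (iB.const_mul 2)) iL)
    simp only
    ring
  have hnorm : ∫ x, ‖f x • X x + w x • grad f x‖ ^ 2 ∂(vol M) =
      ∫ x, ‖X x‖ ^ 2 * f x ^ 2 ∂(vol M) +
      2 * ∫ x, w x * f x * (inner ℝ (X x) (grad f x) : ℝ) ∂(vol M) +
      ∫ x, w x ^ 2 * ‖grad f x‖ ^ 2 ∂(vol M) := by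
    rw [← integral_const_mul, ← integral_add iA (iC.const_mul 2)]
    refine Eq.trans (integral_congr_ae (.of_forall fun x => ?_))
      (integral_add (iA.add (iC.const_mul 2)) iE)
    simp only [norm_add_sq_real, norm_smul, real_inner_smul_left, real_inner_smul_right, mul_pow,
      Real.norm_eq_abs, sq_abs]
    ring
  have hray := hW.firstDirichletEigenvalue_mul_le hΩ hf
  rw [hnorm] at hray
  have hcomp : ∫ x, κ x * w x ^ 2 * f x ^ 2 ∂(vol M) ≤
      firstDirichletEigenvalue Ω * ∫ x, (f x * w x) ^ 2 ∂(vol M) := by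
    have h : ∀ x, firstDirichletEigenvalue Ω * (w x ^ 2 * f x ^ 2) =
        firstDirichletEigenvalue Ω * (f x * w x) ^ 2 := fun x => by ring
    rw [← integral_const_mul]
    simp_rw [← h]
    refine integral_mono_ae iB (iW.const_mul _) ?_
    filter_upwards [(ae_restrict_iff' hΩ.measurableSet).1 hκ] with x hx
    by_cases hxΩ : x ∈ Ω
    · rw [mul_assoc]
      exact mul_le_mul_of_nonneg_right (hx hxΩ) (by positivity)
    · simp [hf.eq_zero hxΩ]
  rw [setIntegral_eq_integral_of_forall_compl_eq_zero fun x hx => by simp [hf.eq_zero hx],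
    setIntegral_eq_integral_of_forall_compl_eq_zero fun x hx => by simp [hG.eq_zero hx]]
  simp_rw [sq_abs]
  -- The weak equation with `hL` gives B = 2A + 2C, and `hcomp` with `hray` gives B ≤ A + 2C + E.
  -- The cross term, whose sign is unknown, cancels.
  linarith

end Inequality

end WeightedCKN

end

/-- Generalized Caffarelli–Kohn–Nirenberg inequality on a Riemannian surface. -/
theorem mainTheorem1
    {M : Type*} [TopologicalSpace M] [T2Space M] [SecondCountableTopology M]
    [ChartedSpace WeightedCKN.Plane M] [IsManifold (𝓡 2) ∞ M]
    [RiemannianBundle (fun x : M => TangentSpace (𝓡 2) x)]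
    [IsContMDiffRiemannianBundle (𝓡 2) ∞ WeightedCKN.Plane
      (fun x : M => TangentSpace (𝓡 2) x)]
    [MeasurableSpace M] [BorelSpace M]
    (Ω : Set M) (hΩ : IsOpen Ω)
    (κ w : M → ℝ) (gradw : Π x : M, TangentSpace (𝓡 2) x)
    (hw : WeightedCKN.IsWeight Ω κ w gradw)
    (hκ : ∀ᵐ x ∂((WeightedCKN.vol M).restrict Ω),
      κ x ≤ WeightedCKN.firstDirichletEigenvalue Ω)
    (f : M → ℝ) (hf : WeightedCKN.IsTestFunction Ω f) :
    ∫ x in Ω, ‖gradw x‖ ^ 2 * |f x| ^ 2 ∂(WeightedCKN.vol M) ≤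
      ∫ x in Ω, w x ^ 2 * ‖WeightedCKN.grad f x‖ ^ 2 ∂(WeightedCKN.vol M) := by
  exact hw.integral_sq_mul_le hΩ hκ hf
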